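/- Definitions. For strict partitions $\mu\subseteq\lambda$, the shifted skew diagram of $\lambda/\mu$ is the set of boxes $(i,j)$ (row $i$ counted from the top, column $j$ from the left) with $1\le i\le \ell(\lambda)$ and $i+\mu_i\le j\le i+\lambda_i-1$, where $\mu_i=0$ for $i>\ell(\mu)$. The skew Schur $Q$-function is $Q_{\lambda/\mu}=\sum_T x^{c(T)}$, where $T$ runs over the fillings of this diagram with letters of the ordered alphabet $1'<1<2'<2<\cdots$ such that rows and columns are weakly increasing, each column contains each unmarked letter $k$ at most once, and each row contains each marked letter $k'$ at most once; $x^{c(T)}=\prod_i x_i^{c_i}$ with $c_i$ the number of letters $i$ or $i'$ in $T$. A symmetric function is $p$-positive if it is a linear combination with nonnegative rational coefficients of products $p_\nu=p_{\nu_1}p_{\nu_2}\cdots$ of power sums $p_r=\sum_i x_i^r$, $\nu$ ranging over partitions. A ribbon is a (nonempty) edgewise connected shifted skew diagram $D$ such that $(i,j)\in D$ implies $(i-1,j-1)\notin D$. If $D$ is the shifted skew diagram of $\lambda/\mu$, put $\mathfrak r_D=Q_{\lambda/\mu}$. Let $\alpha_1(D),\dots,\alpha_\ell(D)$ be the numbers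 of boxes in the nonempty rows of $D$ from top to bottom; $\ell$ is the length of $D$. The head length of $D$ is the smallest $i$ with $\alpha_i(D)\ge 2$. The tail length of $D$ is $\alpha_\ell(D)$ if $\alpha_\ell(D)>1$, and otherwise the smallest $j\ge1$ with $\alpha_{\ell-j+1}(D)\ge2$. (Both exist for the ribbons below.) Let $\triangle_{n,k}$ ($1\le k\le n$) be the ribbon of $(n,n-1,\dots,n-k+1)/(n-1,n-2,\dots,n-k+1)$, with denominator $\emptyset$ if $k=1$. Write $D^t$ for the reflection of $D$ in the main diagonal and $D^\circ$ for its rotation by $180^\circ$. Let $\mathfrak B$ be the set, up to translation, of all $\triangle_{n,1}$ and $(\triangle_{n,1})^t$ with $n\ge1$, and of all $\triangle_{n,3}$, $(\triangle_{n,3})^t$, $(\triangle_{n,3})^\circ$, $((\triangle_{n,3})^t)^\circ$ with $n\ge3$. Theorem. Let $D\notin\mathfrak B$ be a ribbon with an odd number of boxes and odd length $\ell$ such that $\alpha_1(D)=1$, and let $k$ and $m$ be its head length and tail length. Then $\mathfrak r_D$ is not $p$-positive in each of the following cases: (a) $\alpha_\ell(D)>1$ and $k$ is even; (b) $\alpha_\ell(D)>1$,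 $k$ is odd and $m$ is even; (c) $\alpha_\ell(D)=1$ and $k=m$. -/

import Mathlib

/-! ### Strict partitions and shifted skew diagrams -/

/-- A strict partition, as the list of its parts: positive and strictly decreasing. -/
def IsStrictPartition (lam : List ℕ) : Prop :=
  lam.Pairwise (· > ·) ∧ ∀ a ∈ lam, 0 < a

/-- Containment of partitions: `mu_i ≤ lam_i` for every `i ≤ ℓ(mu)`
(missing parts count as `0`). -/
def PartitionLE (mu lam : List ℕ) : Prop :=
  ∀ i < mu.length, mu.getD i 0 ≤ lam.getD i 0

/-- A diagram is a finite set of boxes `(row, column)`; rows are counted from top to bottom,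
columns from left to right. -/
abbrev Diagram := Finset (ℤ × ℤ)

/-- The shifted skew diagram of `lam / mu`.  Rows and columns are numbered from `0`, so that row `i`
consists of the boxes `(i, j)` with `i + mu_i ≤ j < i + lam_i`. -/
def shiftedSkewDiagram (lam mu : List ℕ) : Diagram :=
  (Finset.range lam.length).biUnion fun i =>
    (Finset.Ico (i + mu.getD i 0) (i + lam.getD i 0)).image fun j : ℕ => ((i : ℤ), (j : ℤ))

namespace Diagram

/-- Two boxes sharing an edge. -/
def Adjacent (a b : ℤ × ℤ) : Prop :=
  (a.1 = b.1 ∧ (b.2 = a.2 + 1 ∨ a.2 = b.2 + 1)) ∨ (a.2 = b.2 ∧ (b.1 = a.1 + 1 ∨ a.1 = b.1 + 1))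

/-- A diagram with exactly one edgewise connected component. -/
def IsConnected (D : Diagram) : Prop :=
  D.Nonempty ∧ ∀ a ∈ D, ∀ b ∈ D,
    Relation.ReflTransGen (fun x y => x ∈ D ∧ y ∈ D ∧ Adjacent x y) a b

/-- The ribbon condition: no box has its north-west diagonal neighbour in the diagram. -/
def IsRibbon (D : Diagram) : Prop :=
  ∀ b ∈ D, (b.1 - 1, b.2 - 1) ∉ D

/-- The sequence `α(D) = (α_1(D), …, α_ℓ(D))` of the numbers of boxes in the nonempty rows of `D`,
from top to bottom. -/
def rowSizes (D : Diagram) : List ℕ :=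
  ((D.image Prod.fst).sort (· ≤ ·)).map fun i => (D.filter fun b => b.1 = i).card

/-- The length of `D`, i.e. its number of rows. -/
def length (D : Diagram) : ℕ := D.rowSizes.length

/-- The number of boxes in the first row. -/
def firstRow (D : Diagram) : ℕ := D.rowSizes.headD 0

/-- The number of boxes in the last row. -/
def lastRow (D : Diagram) : ℕ := D.rowSizes.getLastD 0

/-- The head length: the smallest (one-based) index of a row with at least two boxes. -/
def headLength (D : Diagram) : ℕ := D.rowSizes.findIdx (fun a => decide (2 ≤ a)) + 1

/-- The tail length: if the last row is a single box, the smallest `j ≥ 1` such that the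
`j`-th row from the bottom has at least two boxes; otherwise the size of the last row. -/
def tailLength (D : Diagram) : ℕ :=
  if D.lastRow = 1 then D.rowSizes.reverse.findIdx (fun a => decide (2 ≤ a)) + 1 else D.lastRow

/-- Reflection in the main diagonal. -/
def transpose (D : Diagram) : Diagram := D.image fun b => (b.2, b.1)

/-- Antipodal rotation, i.e. rotation by 180 degrees. -/
def rotate (D : Diagram) : Diagram := D.image fun b => (-b.1, -b.2)

/-- `D` is a translate of `B`, i.e. they have the same shape. -/
def IsTranslate (B D : Diagram) : Prop :=
  ∃ v : ℤ × ℤ, D = B.image fun b => b + v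

/-- The ribbon `△_{n,k}`, for `1 ≤ k ≤ n`: the shifted skew diagram of
`(n, n-1, …, n-k+1) / (n-1, n-2, …, n-k+1)`. -/
def triangle (n k : ℕ) : Diagram :=
  shiftedSkewDiagram ((List.range k).map fun i => n - i) ((List.range (k - 1)).map fun i => n - 1 - i)

/-- The basic blocks of size `n`: `△_{n,1}` and its transpose and, when `△_{n,3}` exists,
`△_{n,3}` with its transpose, its antipodal rotation and the antipodal rotation of its transpose. -/
def basicBlocks (n : ℕ) : Set Diagram :=
  {B | B = triangle n 1 ∨ B = (triangle n 1).transpose ∨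
    (3 ≤ n ∧ (B = triangle n 3 ∨ B = (triangle n 3).transpose ∨ B = (triangle n 3).rotate ∨
      B = (triangle n 3).transpose.rotate))}

/-- Membership in the set `𝔅` of all basic blocks; as usual for ribbons, diagrams are compared up to
translation. -/
def IsBasicBlock (D : Diagram) : Prop :=
  ∃ n : ℕ, 1 ≤ n ∧ ∃ B ∈ basicBlocks n, IsTranslate B D

end Diagram

/-! ### Skew Schur Q-functions -/

/-- The alphabet `1' < 1 < 2' < 2 < ⋯`, with letters numbered from `0`: `(k, false)` is the
marked letter `k'` and `(k, true)` is the unmarked letter `k`, in lexicographic order. -/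
abbrev Letter := ℕ ×ₗ Bool

/-- The unmarked version `|a|` of a letter `a`. -/
def Letter.index (a : Letter) : ℕ := (ofLex a).1

/-- Whether a letter is unmarked. -/
def Letter.Unmarked (a : Letter) : Prop := (ofLex a).2 = true

/-- Marked shifted tableaux of shape `D`: rows and columns weakly increase, an unmarked letter
appears at most once in each column, and a marked letter at most once in each row. -/
structure IsMarkedShiftedTableau (D : Diagram) (T : {b : ℤ × ℤ // b ∈ D} → Letter) : Prop where
  row_le : ∀ a b, a.1.1 = b.1.1 → a.1.2 ≤ b.1.2 → T a ≤ T b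
  col_le : ∀ a b, a.1.2 = b.1.2 → a.1.1 ≤ b.1.1 → T a ≤ T b
  col_unmarked : ∀ a b, a.1.2 = b.1.2 → T a = T b → (T a).Unmarked → a = b
  row_marked : ∀ a b, a.1.1 = b.1.1 → T a = T b → ¬ (T a).Unmarked → a = b

/-- The content of a filling: the number of letters `k` or `k'`, for each `k`. -/
noncomputable def content (D : Diagram) (T : {b : ℤ × ℤ // b ∈ D} → Letter) : ℕ →₀ ℕ :=
  ∑ b, Finsupp.single (T b).index 1

/-- The marked shifted tableaux of shape `D` and content `c`. -/
def tableaux (D : Diagram) (c : ℕ →₀ ℕ) : Set ({b : ℤ × ℤ // b ∈ D} → Letter) :=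
  {T | IsMarkedShiftedTableau D T ∧ content D T = c}

/-- There are finitely many tableaux with a given shape and content, so that counting them
by `Set.ncard` below is meaningful. -/
theorem tableaux_finite (D : Diagram) (c : ℕ →₀ ℕ) : (tableaux D c).Finite := by
  have hfin : {a : Letter | a.index ∈ c.support}.Finite := by
    refine Set.Finite.subset
      (((c.support ×ˢ (Finset.univ : Finset Bool)).image toLex).finite_toSet) ?_
    intro a ha
    simp only [Finset.coe_image, Set.mem_image, Finset.mem_coe, Finset.mem_product]
    exact ⟨ofLex a, ⟨ha, Finset.mem_univ _⟩, rfl⟩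
  refine (Set.Finite.pi' fun _ : {b : ℤ × ℤ // b ∈ D} => hfin).subset ?_
  rintro T ⟨-, hT⟩ b
  have h1 : (1 : ℕ) ≤ content D T (T b).index := by
    rw [content, Finsupp.finsetSum_apply]
    refine le_trans ?_ (Finset.single_le_sum
      (f := fun b' => (Finsupp.single (T b').index 1 : ℕ →₀ ℕ) (T b).index)
      (fun _ _ => Nat.zero_le _) (Finset.mem_univ b))
    simp
  rw [hT] at h1
  exact Finsupp.mem_support_iff.2 (by omega)

/-- The generating function `∑_T x^{c(T)}` over all marked shifted tableaux `T` of shape `D`, as a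
power series in infinitely many variables: the coefficient of `x^c` is the number of `T` with
content `c`. -/
noncomputable def tableauSeries (D : Diagram) : MvPowerSeries ℕ ℚ :=
  fun c => ((tableaux D c).ncard : ℚ)

/-- The skew Schur Q-function `Q_{lam / mu}`. -/
noncomputable def skewSchurQ (lam mu : List ℕ) : MvPowerSeries ℕ ℚ :=
  tableauSeries (shiftedSkewDiagram lam mu)

/-! ### Power sums and p-positivity -/

open Classical in
/-- The power sum `p_r = ∑_i x_i^r` in infinitely many variables, for `r ≥ 1`. -/
noncomputable def powerSum (r : ℕ) : MvPowerSeries ℕ ℚ :=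
  fun c => if ∃ i, c = Finsupp.single i r then 1 else 0

/-- `p_ν`, the product of `p_{ν_i}` over the parts of the partition `ν`. -/
noncomputable def powerSumPartition {n : ℕ} (ν : n.Partition) : MvPowerSeries ℕ ℚ :=
  (ν.parts.map powerSum).prod

/-- `f` is a (finite) linear combination of the `p_ν` with nonnegative coefficients. -/
def IsPPositive (f : MvPowerSeries ℕ ℚ) : Prop :=
  ∃ c : (Σ n : ℕ, n.Partition) →₀ ℚ,
    (∀ ν, 0 ≤ c ν) ∧ f = c.sum fun ν a => a • powerSumPartition ν.2

/-! ### Chains of letters -/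

section Chains

variable {R : Type*} [CommRing R]

/-- The order relation imposed on two consecutive entries of a row, for letters encoded so that
`2 * k` is the marked and `2 * k + 1` the unmarked letter of index `k`. -/
def RowRel (i j : ℕ) : Prop := i < j + j % 2

instance (i j : ℕ) : Decidable (RowRel i j) := inferInstanceAs (Decidable (_ < _))

/-- The transfer operator that appends a letter along a row. -/
def rowTransfer (M : ℕ) (y v : ℕ → R) (j : ℕ) : R :=
  y j * ∑ i ∈ Finset.range M with RowRel i j, v i

/-- The weighted number of words of length `n + 1` ending in `j` whose `p`-th step is a column
step for `p ∈ V` and a row step otherwise. -/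
def wordWeight (M : ℕ) (y : ℕ → R) (V : ℕ → Prop) [DecidablePred V] : ℕ → ℕ → R
  | 0 => y
  | n + 1 => fun j =>
      y j * ∑ i ∈ Finset.range M with (if V (n + 1) then ¬ RowRel i j else RowRel i j),
        wordWeight M y V n i

/-- The weighted number of row words of length `n` in the letters below `M`. -/
def rowTotal (y : ℕ → R) (M : ℕ) : ℕ → R
  | 0 => 1
  | n + 1 => ∑ j ∈ Finset.range M, (rowTransfer M y)^[n] y j

lemma rowTotal_zero (y : ℕ → R) (M : ℕ) : rowTotal y M 0 = 1 := rfl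

/-- The signed total weight of the words of length `n ≥ 1`. -/
def signedTotal (M : ℕ) (y : ℕ → R) (V : ℕ → Prop) [DecidablePred V] (n : ℕ) : R :=
  (∏ p ∈ Finset.range (n - 1), if V (p + 1) then (-1 : R) else 1) *
    ∑ j ∈ Finset.range M, wordWeight M y V (n - 1) j

lemma rowTransfer_add (M : ℕ) (y v w : ℕ → R) :
    rowTransfer M y (v + w) = rowTransfer M y v + rowTransfer M y w := by
  ext j
  simp [rowTransfer, Finset.sum_add_distrib, mul_add]

lemma rowTransfer_smul (M : ℕ) (y v : ℕ → R) (c : R) :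
    rowTransfer M y (c • v) = c • rowTransfer M y v := by
  ext j
  simp only [rowTransfer, Pi.smul_apply, smul_eq_mul, ← Finset.mul_sum]
  ring

lemma rowTransfer_sum (M : ℕ) (y : ℕ → R) {ι : Type*} (s : Finset ι) (v : ι → ℕ → R) :
    rowTransfer M y (∑ i ∈ s, v i) = ∑ i ∈ s, rowTransfer M y (v i) := by
  classical
  induction s using Finset.induction_on with
  | empty => ext j; simp [rowTransfer]
  | insert i s hi ih => rw [Finset.sum_insert hi, Finset.sum_insert hi, rowTransfer_add, ih]

lemma wordWeight_succ_of_col (M : ℕ) (y : ℕ → R) (V : ℕ → Prop) [DecidablePred V] (n : ℕ)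
    (h : V (n + 1)) :
    wordWeight M y V (n + 1) =
      (∑ i ∈ Finset.range M, wordWeight M y V n i) • y - rowTransfer M y (wordWeight M y V n) := by
  ext j
  have := Finset.sum_filter_add_sum_filter_not (Finset.range M) (fun i => RowRel i j)
    (wordWeight M y V n)
  simp only [wordWeight, h, if_true, Pi.sub_apply, Pi.smul_apply, smul_eq_mul, rowTransfer,
    ← this]
  ring

lemma wordWeight_succ_of_row (M : ℕ) (y : ℕ → R) (V : ℕ → Prop) [DecidablePred V] (n : ℕ)
    (h : ¬ V (n + 1)) :
    wordWeight M y V (n + 1) = rowTransfer M y (wordWeight M y V n) := by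
  ext j
  simp only [wordWeight, h, if_false, rowTransfer]

lemma signed_wordWeight_eq (M : ℕ) (y : ℕ → R) (V : ℕ → Prop) [DecidablePred V] (n : ℕ) :
    (∏ p ∈ Finset.range n, if V (p + 1) then (-1 : R) else 1) • wordWeight M y V n =
      (rowTransfer M y)^[n] y - ∑ p ∈ Finset.range n,
        (if V (p + 1) then signedTotal M y V (p + 1) else 0) •
          (rowTransfer M y)^[n - 1 - p] y := by
  induction n with
  | zero => simp [wordWeight]
  | succ n ih =>
    set ε : R := ∏ p ∈ Finset.range n, if V (p + 1) then (-1 : R) else 1 with hε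
    have key : rowTransfer M y (ε • wordWeight M y V n) =
        (rowTransfer M y)^[n + 1] y - ∑ p ∈ Finset.range n,
        (if V (p + 1) then signedTotal M y V (p + 1) else 0) •
          (rowTransfer M y)^[n - p] y := by
      rw [ih, sub_eq_add_neg, ← neg_one_smul R (∑ p ∈ Finset.range n, _), rowTransfer_add,
        rowTransfer_smul, rowTransfer_sum, neg_one_smul, ← sub_eq_add_neg,
        ← Function.iterate_succ_apply' (rowTransfer M y)]
      congr 1
      refine Finset.sum_congr rfl fun p hp => ?_
      have : n - p = (n - 1 - p) + 1 := by have := Finset.mem_range.1 hp; omega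
      rw [rowTransfer_smul, this, Function.iterate_succ_apply']
    rw [Finset.prod_range_succ, Finset.sum_range_succ, ← hε]
    have h0 : n + 1 - 1 - n = 0 := by omega
    have h1 : ∀ p, n + 1 - 1 - p = n - p := fun p => by omega
    simp only [h1, Nat.sub_self, Function.iterate_zero, id]
    rw [← sub_sub, ← key, rowTransfer_smul]
    by_cases h : V (n + 1)
    · rw [wordWeight_succ_of_col _ _ _ _ h]
      simp only [h, if_true, signedTotal, Nat.add_sub_cancel, ← hε]
      ext j
      simp only [Pi.smul_apply, Pi.sub_apply, smul_eq_mul]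
      ring
    · rw [wordWeight_succ_of_row _ _ _ _ h]
      simp [h]

/-- Inclusion-exclusion over the last column step. -/
lemma signedTotal_succ (M : ℕ) (y : ℕ → R) (V : ℕ → Prop) [DecidablePred V] (n : ℕ) :
    signedTotal M y V (n + 1) = rowTotal y M (n + 1) - ∑ p ∈ Finset.range n,
        (if V (p + 1) then signedTotal M y V (p + 1) else 0) * rowTotal y M (n - p) := by
  have := congrArg (fun v : ℕ → R => ∑ j ∈ Finset.range M, v j) (signed_wordWeight_eq M y V n)
  simp only [Pi.smul_apply, Pi.sub_apply, Finset.sum_sub_distrib, Finset.sum_apply, smul_eq_mul,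
    ← Finset.mul_sum] at this
  rw [signedTotal, Nat.add_sub_cancel, this, Finset.sum_comm]
  congr 1
  refine Finset.sum_congr rfl fun p hp => ?_
  have : n - p = (n - 1 - p) + 1 := by have := Finset.mem_range.1 hp; omega
  rw [← Finset.mul_sum, this]
  rfl

/-- The generating function of the row words. -/
noncomputable def rowSeries (y : ℕ → R) (M : ℕ) : PowerSeries R := PowerSeries.mk (rowTotal y M)

/-- The generating function of the signed totals. -/
noncomputable def signedSeries (M : ℕ) (y : ℕ → R) (V : ℕ → Prop) [DecidablePred V] :
    PowerSeries R :=
  PowerSeries.mk fun n => if n = 0 then 0 else signedTotal M y V n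

/-- The part of `signedSeries` supported on column steps. -/
noncomputable def signedColSeries (M : ℕ) (y : ℕ → R) (V : ℕ → Prop) [DecidablePred V] :
    PowerSeries R :=
  PowerSeries.mk fun n => if n = 0 then 0 else if V n then signedTotal M y V n else 0

lemma signedSeries_eq (M : ℕ) (y : ℕ → R) (V : ℕ → Prop) [DecidablePred V] :
    signedSeries M y V =
      (rowSeries y M - 1) - signedColSeries M y V * (rowSeries y M - 1) := by
  ext n
  cases n with
  | zero => simp [signedSeries, signedColSeries, rowSeries, rowTotal]
  | succ n =>
    rw [map_sub, PowerSeries.coeff_mul, Finset.Nat.sum_antidiagonal_eq_sum_range_succ_mk,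
      Finset.sum_range_succ, Finset.sum_range_succ']
    simp only [signedSeries, signedColSeries, rowSeries, PowerSeries.coeff_mk, map_sub,
      PowerSeries.coeff_one, Nat.succ_ne_zero, if_false, if_true, sub_zero,
      Nat.add_sub_add_right, Nat.sub_self, rowTotal_zero, sub_self, mul_zero, zero_mul, add_zero]
    rw [signedTotal_succ]
    congr 1
    refine Finset.sum_congr rfl fun p hp => ?_
    have : n - p ≠ 0 := by have := Finset.mem_range.1 hp; omega
    simp only [this, if_false, sub_zero]

lemma filter_rowRel (K j : ℕ) (h : j + j % 2 ≤ K) :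
    {i ∈ Finset.range K | RowRel i j} = Finset.range (j + j % 2) := by
  ext i
  rw [Finset.mem_filter, Finset.mem_range, Finset.mem_range, RowRel]
  omega

lemma rowTransfer_iterate_congr (y : ℕ → R) (M M' n j : ℕ) (h : j + j % 2 ≤ M)
    (h' : j + j % 2 ≤ M') : (rowTransfer M y)^[n] y j = (rowTransfer M' y)^[n] y j := by
  induction n generalizing j with
  | zero => rfl
  | succ n ih =>
    rw [Function.iterate_succ_apply', Function.iterate_succ_apply', rowTransfer, rowTransfer,
      filter_rowRel M j h, filter_rowRel M' j h']
    congr 1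
    refine Finset.sum_congr rfl fun i hi => ?_
    have hi := Finset.mem_range.1 hi
    apply ih i <;> omega

lemma rowTransfer_iterate_last (y : ℕ → R) (M n : ℕ) :
    (rowTransfer (M + 1) y)^[n] y M = y M * rowTotal y (M + M % 2) n := by
  cases n with
  | zero => simp [rowTotal]
  | succ n =>
    rw [Function.iterate_succ_apply', rowTransfer, filter_rowRel _ _ (by omega), rowTotal]
    congr 1
    refine Finset.sum_congr rfl fun i hi => ?_
    have hi := Finset.mem_range.1 hi
    apply rowTransfer_iterate_congr <;> omega

lemma rowTotal_succ (y : ℕ → R) (M n : ℕ) :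
    rowTotal y (M + 1) (n + 1) =
      rowTotal y M (n + 1) + y M * rowTotal y (M + M % 2) n := by
  rw [rowTotal, Finset.sum_range_succ, rowTransfer_iterate_last, rowTotal]
  congr 1
  refine Finset.sum_congr rfl fun i hi => ?_
  have hi := Finset.mem_range.1 hi
  apply rowTransfer_iterate_congr <;> omega

lemma rowSeries_zero (y : ℕ → R) : rowSeries y 0 = 1 := by
  ext n
  cases n <;> simp [rowSeries, rowTotal, PowerSeries.coeff_one]

lemma rowSeries_succ (y : ℕ → R) (M : ℕ) :
    rowSeries y (M + 1) =
      rowSeries y M + PowerSeries.X * (PowerSeries.C (y M) * rowSeries y (M + M % 2)) := by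
  ext n
  cases n with
  | zero => simp [rowSeries, rowTotal]
  | succ n =>
    rw [map_add, PowerSeries.coeff_succ_X_mul, PowerSeries.coeff_C_mul]
    simp only [rowSeries, PowerSeries.coeff_mk, rowTotal_succ]

/-- The generating function of the row words is `∏ (1 + a i X) / (1 - a i X)`. -/
lemma rowSeries_mul_prod (a : ℕ → R) (N : ℕ) :
    rowSeries (fun j => a (j / 2)) (2 * N) *
        ∏ i ∈ Finset.range N, (1 - PowerSeries.C (a i) * PowerSeries.X) =
      ∏ i ∈ Finset.range N, (1 + PowerSeries.C (a i) * PowerSeries.X) := by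
  induction N with
  | zero => simp [rowSeries_zero]
  | succ N ih =>
    have h1 := rowSeries_succ (fun j => a (j / 2)) (2 * N)
    have h2 := rowSeries_succ (fun j => a (j / 2)) (2 * N + 1)
    have e1 : 2 * N + 2 * N % 2 = 2 * N := by omega
    have e2 : 2 * N + 1 + (2 * N + 1) % 2 = 2 * N + 2 := by omega
    have e3 : (2 * N + 1) / 2 = N := by omega
    have e4 : 2 * N / 2 = N := by omega
    simp only [e1, e2, e3, e4] at h1 h2
    rw [Finset.prod_range_succ, Finset.prod_range_succ, ← ih, Nat.mul_succ]
    linear_combination (∏ i ∈ Finset.range N, (1 - PowerSeries.C (a i) * PowerSeries.X)) * (h1 + h2)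

end Chains

/-! ### The multilinear part of the signed series -/

section Multilinear

open PowerSeries

variable {K : Type*} [CommRing K]

lemma eq_of_mul_prod_one_sub {S : Type*} [CommRing S] {E p q r : S} (hp : p * p = 0)
    (hq : q * q = 0) (hr : r * r = 0)
    (h : E * ((1 - p) * (1 - q) * (1 - r)) = (1 + p) * (1 + q) * (1 + r)) :
    E = (1 + 2 * p) * (1 + 2 * q) * (1 + 2 * r) := by
  have inv : ∀ {x : S}, x * x = 0 → (1 - x) * (1 + x) = 1 := fun hx => by
    linear_combination -hx
  have sq : ∀ {x : S}, x * x = 0 → (1 + x) * (1 + x) = 1 + 2 * x := fun hx => by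
    linear_combination hx
  calc E = E * ((1 - p) * (1 + p)) * ((1 - q) * (1 + q)) * ((1 - r) * (1 + r)) := by
        rw [inv hp, inv hq, inv hr, mul_one, mul_one, mul_one]
    _ = E * ((1 - p) * (1 - q) * (1 - r)) * ((1 + p) * (1 + q) * (1 + r)) := by ring
    _ = (1 + p) * (1 + p) * ((1 + q) * (1 + q)) * ((1 + r) * (1 + r)) := by rw [h]; ring
    _ = _ := by rw [sq hp, sq hq, sq hr]

lemma coeff_mul_C_mul_X_pow (M : K⟦X⟧) (hM : coeff 0 M = 0) (r : K) (d n : ℕ) :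
    coeff n (M * (C r * X ^ d)) = r * coeff (n - d) M := by
  rw [show M * (C r * X ^ d) = C r * (M * X ^ d) by ring, coeff_C_mul, coeff_mul_X_pow']
  split_ifs with h
  · rfl
  · rw [Nat.sub_eq_zero_of_le (by omega), hM]

/-- The relations between the signed series `N`, its part `s n * N n` on the column steps, and the
series of row words for three square-zero weights. -/
structure IsRibbonSystem (N : K⟦X⟧) (s : ℕ → K) (U V W : K) (a b c : ℕ) : Prop where
  sqU : U * U = 0
  sqV : V * V = 0
  sqW : W * W = 0
  posa : 0 < a
  posb : 0 < b
  posc : 0 < c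
  zero : s 0 = 0
  eq : ∃ E : K⟦X⟧, E = (1 + 2 * (C U * X ^ a)) * (1 + 2 * (C V * X ^ b)) * (1 + 2 * (C W * X ^ c)) ∧
    N = (E - 1) - PowerSeries.mk (fun n => s n * coeff n N) * (E - 1)

namespace IsRibbonSystem

variable {N : K⟦X⟧} {s : ℕ → K} {U V W : K} {a b c : ℕ}

lemma of_rowSeries {R : Type*} [CommRing R] (π : R →+* K) {M : ℕ} {y : ℕ → R} {u v w : R}
    (hu : π u * π u = 0) (hv : π v * π v = 0) (hw : π w * π w = 0) (ha : 0 < a) (hb : 0 < b)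
    (hc : 0 < c) (V : ℕ → Prop) [DecidablePred V] (hV : ¬ V 0)
    (h : rowSeries y M * ((1 - C u * X ^ a) * (1 - C v * X ^ b) * (1 - C w * X ^ c)) =
      (1 + C u * X ^ a) * (1 + C v * X ^ b) * (1 + C w * X ^ c)) :
    IsRibbonSystem (PowerSeries.map π (signedSeries M y V)) (fun n => if V n then 1 else 0)
      (π u) (π v) (π w) a b c := by
  refine ⟨hu, hv, hw, ha, hb, hc, if_neg hV, PowerSeries.map π (rowSeries y M), ?_, ?_⟩
  · replace h := congrArg (PowerSeries.map π) h
    simp only [map_mul, map_sub, map_add, map_one, map_pow, PowerSeries.map_C, PowerSeries.map_X]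
      at h
    have sq : ∀ (x : K) (n : ℕ), x * x = 0 → (C x * X ^ n) * (C x * X ^ n) = 0 := by
      intro x n hx
      rw [mul_mul_mul_comm, ← map_mul, hx, map_zero, zero_mul]
    exact eq_of_mul_prod_one_sub (sq _ a hu) (sq _ b hv) (sq _ c hw) h
  · replace h := congrArg (PowerSeries.map π) (signedSeries_eq M y V)
    rw [map_sub, map_mul, map_sub, map_one] at h
    rw [h]
    congr 2
    rw [← h]
    ext n
    simp only [signedColSeries, signedSeries, PowerSeries.coeff_map, PowerSeries.coeff_mk]
    by_cases h0 : n = 0 <;> by_cases h1 : V n <;> simp [h0, h1]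

lemma perm (h : IsRibbonSystem N s U V W a b c) : IsRibbonSystem N s V W U b c a := by
  obtain ⟨h1, h2, h3, h4, h5, h6, h7, E, h8, h9⟩ := h
  exact ⟨h2, h3, h1, h5, h6, h4, h7, E, by rw [h8]; ring, h9⟩

lemma swap (h : IsRibbonSystem N s U V W a b c) : IsRibbonSystem N s V U W b a c := by
  obtain ⟨h1, h2, h3, h4, h5, h6, h7, E, h8, h9⟩ := h
  exact ⟨h2, h1, h3, h5, h4, h6, h7, E, by rw [h8]; ring, h9⟩

lemma coeff_eq (h : IsRibbonSystem N s U V W a b c) (n : ℕ) (m : ℕ → K)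
    (hm : ∀ n, m n = s n * coeff n N) :
    coeff n N =
      2 * U * ((if n = a then 1 else 0) - m (n - a)) +
      2 * V * ((if n = b then 1 else 0) - m (n - b)) +
      2 * W * ((if n = c then 1 else 0) - m (n - c)) +
      4 * U * V * ((if n = a + b then 1 else 0) - m (n - (a + b))) +
      4 * V * W * ((if n = b + c then 1 else 0) - m (n - (b + c))) +
      4 * U * W * ((if n = a + c then 1 else 0) - m (n - (a + c))) +
      8 * U * V * W * ((if n = a + b + c then 1 else 0) - m (n - (a + b + c))) := by
  obtain ⟨E, hE, hN⟩ := h.eq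
  have hM : (PowerSeries.mk fun n => s n * coeff n N) = PowerSeries.mk m := by
    congr 1; ext n; exact (hm n).symm
  have hM0 : coeff 0 (PowerSeries.mk m) = 0 := by simp [hm, h.zero]
  rw [hM] at hN
  generalize hMM : PowerSeries.mk m = M at hN hM0
  have hE1 : E - 1 = C (2 * U) * X ^ a + C (2 * V) * X ^ b + C (2 * W) * X ^ c +
      C (4 * U * V) * X ^ (a + b) + C (4 * V * W) * X ^ (b + c) + C (4 * U * W) * X ^ (a + c) +
      C (8 * U * V * W) * X ^ (a + b + c) := by
    rw [hE]
    simp only [map_mul, map_ofNat]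
    ring
  rw [hN, hE1]
  simp only [mul_add, map_sub, map_add, coeff_mul_C_mul_X_pow M hM0, coeff_C_mul, coeff_X_pow]
  simp only [← hMM, coeff_mk]
  ring

lemma coeff_single (h : IsRibbonSystem N s U V W a b c) :
    U * V * coeff c N = 2 * U * V * W := by
  have h0 : s (c - c) * coeff (c - c) N = 0 := by simp [h.zero]
  have := h.coeff_eq c (fun n => s n * coeff n N) fun _ => rfl
  simp only [h0, if_true] at this
  generalize ((if c = a then 1 else 0) - s (c - a) * coeff (c - a) N : K) = t1 at this
  generalize ((if c = b then 1 else 0) - s (c - b) * coeff (c - b) N : K) = t2 at this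
  generalize ((if c = a + b then 1 else 0) - _ : K) = t3 at this
  generalize ((if c = b + c then 1 else 0) - _ : K) = t4 at this
  generalize ((if c = a + c then 1 else 0) - _ : K) = t5 at this
  generalize ((if c = a + b + c then 1 else 0) - _ : K) = t6 at this
  rw [this]
  linear_combination (V * (2 * t1 + 4 * V * t3 + 4 * W * t5 + 8 * V * W * t6)) * h.sqU +
    (U * (2 * t2 + 4 * W * t4)) * h.sqV

lemma coeff_pair (h : IsRibbonSystem N s U V W a b c) :
    U * coeff (b + c) N = 4 * U * V * W * (1 - s b - s c) := by
  have h0 : s (b + c - (b + c)) * coeff (b + c - (b + c)) N = 0 := by simp [h.zero]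
  have := h.coeff_eq (b + c) (fun n => s n * coeff n N) fun _ => rfl
  have hb := h.posb
  have hc := h.posc
  have n1 : ¬ (b + c = b) := by omega
  have n2 : ¬ (b + c = c) := by omega
  simp only [h0, if_true, n1, n2, if_false, Nat.add_sub_cancel, Nat.add_sub_cancel_left] at this
  generalize ((if b + c = a then 1 else 0) - _ : K) = t1 at this
  generalize ((if b + c = a + b then 1 else 0) - _ : K) = t3 at this
  generalize ((if b + c = a + c then 1 else 0) - _ : K) = t5 at this
  generalize ((if b + c = a + b + c then 1 else 0) - _ : K) = t6 at this
  rw [this]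
  linear_combination (2 * t1 + 4 * V * t3 + 4 * W * t5 + 8 * V * W * t6) * h.sqU -
    2 * s c * h.coeff_single - 2 * s b * h.perm.perm.coeff_single

lemma coeff_total (h : IsRibbonSystem N s U V W a b c) :
    coeff (a + b + c) N = 8 * U * V * W *
      (1 - s a - s b - s c - s (a + b) * (1 - s a - s b) - s (b + c) * (1 - s b - s c) -
        s (a + c) * (1 - s a - s c)) := by
  have h0 : s (a + b + c - (a + b + c)) * coeff (a + b + c - (a + b + c)) N = 0 := by
    simp [h.zero]
  have := h.coeff_eq (a + b + c) (fun n => s n * coeff n N) fun _ => rfl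
  have ha := h.posa
  have hb := h.posb
  have hc := h.posc
  have n1 : ¬ (a + b + c = a) := by omega
  have n2 : ¬ (a + b + c = b) := by omega
  have n3 : ¬ (a + b + c = c) := by omega
  have n4 : ¬ (a + b + c = a + b) := by omega
  have n5 : ¬ (a + b + c = b + c) := by omega
  have n6 : ¬ (a + b + c = a + c) := by omega
  have e1 : a + b + c - a = b + c := by omega
  have e2 : a + b + c - b = a + c := by omega
  have e3 : a + b + c - c = a + b := by omega
  have e4 : a + b + c - (a + b) = c := by omega
  have e5 : a + b + c - (b + c) = a := by omega
  have e6 : a + b + c - (a + c) = b := by omega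
  simp only [h0, if_true, n1, n2, n3, n4, n5, n6, if_false, e1, e2, e3, e4, e5, e6] at this
  have p2 := h.swap.coeff_pair
  have p3 := h.perm.perm.coeff_pair
  rw [this]
  linear_combination -2 * s (b + c) * h.coeff_pair - 2 * s (a + c) * p2 - 2 * s (a + b) * p3 -
    4 * s c * h.coeff_single - 4 * s b * h.perm.perm.coeff_single - 4 * s a * h.perm.coeff_single

end IsRibbonSystem

end Multilinear

/-! ### Specialisation at roots of unity -/

section Specialisation

open MvPowerSeries
open scoped ComplexOrder

lemma IsPrimitiveRoot.prod_range_sub_pow_mul {R : Type*} [CommRing R] [IsDomain R] {ζ : R} {n : ℕ}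
    (h : IsPrimitiveRoot ζ n) (hn : 0 < n) (x y : R) :
    ∏ i ∈ Finset.range n, (x - ζ ^ i * y) = x ^ n - y ^ n := by
  rw [h.pow_sub_pow_eq_prod_sub_mul x y hn]
  have : NeZero n := ⟨hn.ne'⟩
  refine Finset.prod_bij (fun i _ => ζ ^ i) ?_ ?_ ?_ ?_
  · intro i _
    rw [Polynomial.mem_nthRootsFinset hn, ← pow_mul, mul_comm, pow_mul, h.pow_eq_one, one_pow]
  · intro i hi j hj hij
    exact h.pow_inj (Finset.mem_range.1 hi) (Finset.mem_range.1 hj) hij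
  · intro b hb
    rw [Polynomial.mem_nthRootsFinset hn] at hb
    obtain ⟨i, hi, rfl⟩ := h.eq_pow_of_pow_eq_one hb
    exact ⟨i, Finset.mem_range.2 hi, rfl⟩
  · intro i _
    rfl

lemma IsPrimitiveRoot.sum_range_pow_pow_nonneg {ζ : ℂ} {n : ℕ} (h : IsPrimitiveRoot ζ n) (r : ℕ) :
    0 ≤ ∑ i ∈ Finset.range n, (ζ ^ i) ^ r := by
  by_cases hr : ζ ^ r = 1
  · refine Finset.sum_nonneg fun i _ => ?_
    rw [← pow_mul, mul_comm, pow_mul, hr, one_pow]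
    exact zero_le_one
  · have : (∑ i ∈ Finset.range n, (ζ ^ r) ^ i) * (ζ ^ r - 1) = 0 := by
      rw [geom_sum_mul, ← pow_mul, mul_comm, pow_mul, h.pow_eq_one, one_pow, sub_self]
    have h0 := (mul_eq_zero.1 this).resolve_right (sub_ne_zero.2 hr)
    simp only [← pow_mul, mul_comm _ r] at h0 ⊢
    exact h0.ge

/-- The alphabet consisting of `X 0`, `X 1`, `X 2` times all `a`-th, `b`-th, `c`-th roots of
unity. -/
noncomputable def rootAlphabet (a b c : ℕ) (ζ : ℕ → ℂ) (i : ℕ) : MvPowerSeries (Fin 3) ℂ :=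
  if i < a then C (ζ a ^ i) * X 0
  else if i < a + b then C (ζ b ^ (i - a)) * X 1
  else if i < a + b + c then C (ζ c ^ (i - (a + b))) * X 2
  else 0

variable {a b c : ℕ} {ζ : ℕ → ℂ}

lemma rootAlphabet_eq_zero (a b c : ℕ) (ζ : ℕ → ℂ) {i : ℕ} (h : a + b + c ≤ i) :
    rootAlphabet a b c ζ i = 0 := by
  rw [rootAlphabet, if_neg (by omega), if_neg (by omega), if_neg (by omega)]

lemma constantCoeff_rootAlphabet (a b c : ℕ) (ζ : ℕ → ℂ) (i : ℕ) :
    constantCoeff (rootAlphabet a b c ζ i) = 0 := by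
  rw [rootAlphabet]
  split_ifs <;> simp

@[to_additive]
lemma prod_rootAlphabet {M : Type*} [CommMonoid M] (a b c : ℕ) (ζ : ℕ → ℂ)
    (F : MvPowerSeries (Fin 3) ℂ → M) :
    ∏ i ∈ Finset.range (a + b + c), F (rootAlphabet a b c ζ i) =
      (∏ i ∈ Finset.range a, F (C (ζ a ^ i) * X 0)) * (∏ i ∈ Finset.range b, F (C (ζ b ^ i) * X 1)) *
        ∏ i ∈ Finset.range c, F (C (ζ c ^ i) * X 2) := by
  rw [Finset.prod_range_add, Finset.prod_range_add]
  congr 1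
  · congr 1
    · refine Finset.prod_congr rfl fun i hi => ?_
      rw [rootAlphabet, if_pos (Finset.mem_range.1 hi)]
    · refine Finset.prod_congr rfl fun i hi => ?_
      have := Finset.mem_range.1 hi
      rw [rootAlphabet, if_neg (by omega), if_pos (by omega), Nat.add_sub_cancel_left]
  · refine Finset.prod_congr rfl fun i hi => ?_
    have := Finset.mem_range.1 hi
    rw [rootAlphabet, if_neg (by omega), if_neg (by omega), if_pos (by omega),
      Nat.add_sub_cancel_left]

lemma hasSubst_rootAlphabet (a b c : ℕ) (ζ : ℕ → ℂ) : HasSubst (rootAlphabet a b c ζ) where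
  const_coeff s := by rw [constantCoeff_rootAlphabet]; exact IsNilpotent.zero
  coeff_zero d := by
    refine (Set.finite_Iio (a + b + c)).subset fun i hi => ?_
    by_contra h
    exact hi (by rw [rootAlphabet_eq_zero a b c ζ (not_lt.1 h), map_zero])

/-- Power series with nonnegative coefficients. -/
def NonnegCoeff {τ : Type*} (f : MvPowerSeries τ ℂ) : Prop := ∀ e, 0 ≤ coeff e f

namespace NonnegCoeff

variable {τ : Type*} {f g : MvPowerSeries τ ℂ}

lemma zero : NonnegCoeff (0 : MvPowerSeries τ ℂ) := fun e => by simp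

lemma add (hf : NonnegCoeff f) (hg : NonnegCoeff g) : NonnegCoeff (f + g) := fun e => by
  rw [map_add]; exact add_nonneg (hf e) (hg e)

lemma mul (hf : NonnegCoeff f) (hg : NonnegCoeff g) : NonnegCoeff (f * g) := fun e => by
  classical
  rw [coeff_mul]
  exact Finset.sum_nonneg fun i _ => mul_nonneg (hf _) (hg _)

lemma one : NonnegCoeff (1 : MvPowerSeries τ ℂ) := fun e => by
  classical
  rw [coeff_one]
  split_ifs <;> simp

lemma X_pow (i : τ) (r : ℕ) : NonnegCoeff (X i ^ r : MvPowerSeries τ ℂ) := fun e => by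
  classical
  rw [coeff_X_pow]
  split_ifs <;> simp

lemma C {z : ℂ} (hz : 0 ≤ z) : NonnegCoeff (C z : MvPowerSeries τ ℂ) := fun e => by
  classical
  rw [coeff_C]
  split_ifs <;> simp [hz]

lemma sum {ι : Type*} (s : Finset ι) (F : ι → MvPowerSeries τ ℂ)
    (h : ∀ i ∈ s, NonnegCoeff (F i)) : NonnegCoeff (∑ i ∈ s, F i) :=
  Finset.sum_induction _ _ (fun _ _ => add) zero h

lemma multiset_prod (s : Multiset (MvPowerSeries τ ℂ))
    (h : ∀ f ∈ s, NonnegCoeff f) : NonnegCoeff s.prod :=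
  Multiset.prod_induction _ s (fun _ _ => mul) one h

end NonnegCoeff

/-- Substitution into a power series that counts the elements of a set by their content. -/
lemma subst_counting {τ ι : Type*} {A : ℕ → MvPowerSeries τ ℂ} (hA : HasSubst A)
    (P : ι → Prop) (w : ι → ℕ →₀ ℕ) (f : MvPowerSeries ℕ ℚ)
    (hf : ∀ d, coeff d f = ({t | P t ∧ w t = d}.ncard : ℚ))
    (F : Finset ι) (hFP : ∀ t ∈ F, P t)
    (hF : ∀ t, P t → t ∉ F → ((w t).prod fun i e => A i ^ e) = 0) :
    substAlgHom hA f = ∑ t ∈ F, (w t).prod fun i e => A i ^ e := by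
  classical
  rw [substAlgHom_apply]
  ext e
  rw [coeff_subst hA, map_sum]
  have hsupp : Function.support (fun d => coeff d f • coeff e (d.prod fun s e => A s ^ e)) ⊆
      ↑(F.image w) := by
    intro d hd
    by_contra hd'
    apply hd
    simp only [hf]
    by_cases hne : {t | P t ∧ w t = d} = ∅
    · simp [hne]
    · obtain ⟨t, ht, rfl⟩ := Set.nonempty_iff_ne_empty.2 hne
      have : t ∉ F := fun h => hd' (Finset.mem_coe.2 (Finset.mem_image_of_mem w h))
      simp [hF t ht this]
  rw [finsum_eq_sum_of_support_subset _ hsupp,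
    ← Finset.sum_fiberwise_of_maps_to (fun t ht => Finset.mem_image_of_mem w ht)]
  refine Finset.sum_congr rfl fun d _ => ?_
  rw [Finset.sum_congr rfl (g := fun _ => coeff e (d.prod fun s e => A s ^ e))
    (fun t ht => by rw [(Finset.mem_filter.1 ht).2]), Finset.sum_const, hf]
  by_cases h0 : (d.prod fun s e => A s ^ e) = 0
  · simp [h0]
  · have : {t | P t ∧ w t = d} = ↑(F.filter fun t => w t = d) := by
      ext t
      simp only [Set.mem_ofPred_eq, Finset.coe_filter]
      refine ⟨fun ⟨h1, h2⟩ => ⟨?_, h2⟩, fun ⟨h1, h2⟩ => ⟨hFP t h1, h2⟩⟩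
      by_contra h
      exact h0 (h2 ▸ hF t h1 h)
    rw [this, Set.ncard_coe_finset, Algebra.smul_def, nsmul_eq_mul, map_natCast]

lemma subst_powerSum (a b c : ℕ) (ζ : ℕ → ℂ) {r : ℕ} (hr : 0 < r) :
    substAlgHom (hasSubst_rootAlphabet a b c ζ) (powerSum r) =
      ∑ i ∈ Finset.range (a + b + c), rootAlphabet a b c ζ i ^ r := by
  rw [subst_counting (hasSubst_rootAlphabet a b c ζ) (fun _ : ℕ => True)
    (fun i => Finsupp.single i r) (powerSum r) ?_ (Finset.range (a + b + c)) (fun _ _ => trivial) ?_]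
  · simp
  · intro d
    change powerSum r d = _
    rw [powerSum]
    split_ifs with h
    · obtain ⟨i, rfl⟩ := h
      have : {t : ℕ | True ∧ Finsupp.single t r = Finsupp.single i r} = {i} := by
        ext t
        simp [Finsupp.single_left_inj hr.ne']
      rw [this]
      simp
    · have : {t : ℕ | True ∧ Finsupp.single t r = d} = ∅ := by
        ext t
        simp only [true_and, Set.mem_ofPred_eq, Set.mem_empty_iff_false, iff_false]
        exact fun ht => h ⟨t, ht.symm⟩
      rw [this]
      simp
  · intro i _ hi
    rw [Finset.mem_range, not_lt] at hi
    simp [rootAlphabet_eq_zero a b c ζ hi, hr.ne']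

lemma nonnegCoeff_subst_powerSum (ha : IsPrimitiveRoot (ζ a) a) (hb : IsPrimitiveRoot (ζ b) b)
    (hc : IsPrimitiveRoot (ζ c) c) {r : ℕ} (hr : 0 < r) :
    NonnegCoeff (substAlgHom (hasSubst_rootAlphabet a b c ζ) (powerSum r)) := by
  have key : ∀ (n : ℕ) (i : Fin 3), IsPrimitiveRoot (ζ n) n →
      NonnegCoeff (∑ j ∈ Finset.range n, (C (ζ n ^ j) * X i : MvPowerSeries (Fin 3) ℂ) ^ r) := by
    intro n i hn
    simp only [mul_pow, ← map_pow, ← Finset.sum_mul, ← map_sum]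
    exact (NonnegCoeff.C (hn.sum_range_pow_pow_nonneg r)).mul (NonnegCoeff.X_pow i r)
  rw [subst_powerSum a b c ζ hr, sum_rootAlphabet a b c ζ (fun x => x ^ r)]
  exact ((key a 0 ha).add (key b 1 hb)).add (key c 2 hc)

lemma IsPPositive.nonnegCoeff_subst {f : MvPowerSeries ℕ ℚ} (hf : IsPPositive f)
    (ha : IsPrimitiveRoot (ζ a) a) (hb : IsPrimitiveRoot (ζ b) b)
    (hc : IsPrimitiveRoot (ζ c) c) :
    NonnegCoeff (substAlgHom (hasSubst_rootAlphabet a b c ζ) f) := by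
  obtain ⟨q, hq, rfl⟩ := hf
  rw [Finsupp.sum, map_sum]
  refine NonnegCoeff.sum _ _ fun ν _ => ?_
  rw [map_smul, powerSumPartition, map_multiset_prod, Multiset.map_map]
  have hprod : NonnegCoeff ((ν.2.parts.map
      (substAlgHom (hasSubst_rootAlphabet a b c ζ) ∘ powerSum)).prod) := by
    refine NonnegCoeff.multiset_prod _ fun f hf => ?_
    obtain ⟨r, hr, rfl⟩ := Multiset.mem_map.1 hf
    exact nonnegCoeff_subst_powerSum ha hb hc (ν.2.parts_pos hr)
  intro e
  change 0 ≤ q ν • coeff e (ν.2.parts.map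
    (substAlgHom (hasSubst_rootAlphabet a b c ζ) ∘ powerSum)).prod
  rw [Algebra.smul_def]
  refine mul_nonneg ?_ (hprod e)
  rw [eq_ratCast]
  rw [← Complex.ofReal_ratCast]
  exact Complex.zero_le_real.2 (by exact_mod_cast hq ν)

/-- The power series without monomials dividing `x ^ d`. -/
def truncIdeal {τ : Type*} (d : τ →₀ ℕ) : Ideal (MvPowerSeries τ ℂ) where
  carrier := {f | ∀ e ≤ d, coeff e f = 0}
  zero_mem' e _ := map_zero _
  add_mem' hf hg e he := by rw [map_add, hf e he, hg e he, add_zero]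
  smul_mem' g f hf e he := by
    classical
    rw [smul_eq_mul, coeff_mul]
    refine Finset.sum_eq_zero fun p hp => ?_
    rw [hf p.2 (le_trans _ he), mul_zero]
    rw [← Finset.HasAntidiagonal.mem_antidiagonal.1 hp]
    exact le_add_self

lemma prod_one_sub_rootAlphabet (ha : IsPrimitiveRoot (ζ a) a) (hb : IsPrimitiveRoot (ζ b) b)
    (hc : IsPrimitiveRoot (ζ c) c) (ha0 : 0 < a) (hb0 : 0 < b) (hc0 : 0 < c)
    (t : PowerSeries (MvPowerSeries (Fin 3) ℂ)) :
    ∏ i ∈ Finset.range (a + b + c), (1 - PowerSeries.C (rootAlphabet a b c ζ i) * t) =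
      (1 - PowerSeries.C (X 0 ^ a) * t ^ a) *
      (1 - PowerSeries.C (X 1 ^ b) * t ^ b) *
      (1 - PowerSeries.C (X 2 ^ c) * t ^ c) := by
  have key : ∀ (n : ℕ) (i : Fin 3), IsPrimitiveRoot (ζ n) n → 0 < n →
      ∏ j ∈ Finset.range n, (1 - PowerSeries.C (C (ζ n ^ j) * X i : MvPowerSeries (Fin 3) ℂ) * t) =
        1 - PowerSeries.C (X i ^ n) * t ^ n := by
    intro n i hn hn0
    have h := (hn.map_of_injective (f := Polynomial.C) Polynomial.C_injective).prod_range_sub_pow_mul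
      hn0 1 Polynomial.X
    replace h := congrArg (Polynomial.eval₂RingHom ((PowerSeries.C (R := MvPowerSeries (Fin 3) ℂ)).comp
      (C (σ := Fin 3) (R := ℂ))) (PowerSeries.C (X i) * t)) h
    simp only [map_prod, map_sub, map_mul, map_one, map_pow, one_pow,
      Polynomial.coe_eval₂RingHom, Polynomial.eval₂_C, Polynomial.eval₂_X, RingHom.comp_apply,
      mul_pow] at h ⊢
    rw [← h]
    exact Finset.prod_congr rfl fun j _ => by ring
  rw [prod_rootAlphabet a b c ζ (fun x => 1 - PowerSeries.C x * t), key a 0 ha ha0,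
    key b 1 hb hb0, key c 2 hc hc0]

/-- The exponent of `X 0 ^ a * X 1 ^ b * X 2 ^ c`. -/
noncomputable abbrev truncExponent (a b c : ℕ) : Fin 3 →₀ ℕ :=
  Finsupp.single 0 a + Finsupp.single 1 b + Finsupp.single 2 c

lemma X_pow_mem_truncIdeal {τ : Type*} {d : τ →₀ ℕ} {i : τ} {n : ℕ} (h : d i < n) :
    (X i ^ n : MvPowerSeries τ ℂ) ∈ truncIdeal d := by
  classical
  intro e he
  rw [coeff_X_pow, if_neg]
  rintro rfl
  have := he i
  simp at this
  omega

lemma rowSeries_rootAlphabet (ha : IsPrimitiveRoot (ζ a) a) (hb : IsPrimitiveRoot (ζ b) b)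
    (hc : IsPrimitiveRoot (ζ c) c) (ha' : Odd a) (hb' : Odd b) (hc' : Odd c) :
    rowSeries (fun j => rootAlphabet a b c ζ (j / 2)) (2 * (a + b + c)) *
      ((1 - PowerSeries.C (X 0 ^ a) * PowerSeries.X ^ a) *
      (1 - PowerSeries.C (X 1 ^ b) * PowerSeries.X ^ b) *
      (1 - PowerSeries.C (X 2 ^ c) * PowerSeries.X ^ c)) =
      (1 + PowerSeries.C (X 0 ^ a) * PowerSeries.X ^ a) *
      (1 + PowerSeries.C (X 1 ^ b) * PowerSeries.X ^ b) *
      (1 + PowerSeries.C (X 2 ^ c) * PowerSeries.X ^ c) := by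
  have h := rowSeries_mul_prod (rootAlphabet a b c ζ) (a + b + c)
  have h2 := prod_one_sub_rootAlphabet ha hb hc ha'.pos hb'.pos hc'.pos (-PowerSeries.X)
  simp only [mul_neg, sub_neg_eq_add, ha'.neg_pow, hb'.neg_pow, hc'.neg_pow] at h2
  rw [prod_one_sub_rootAlphabet ha hb hc ha'.pos hb'.pos hc'.pos, h2] at h
  exact h

lemma isRibbonSystem_rootAlphabet (ha : IsPrimitiveRoot (ζ a) a) (hb : IsPrimitiveRoot (ζ b) b)
    (hc : IsPrimitiveRoot (ζ c) c) (ha' : Odd a) (hb' : Odd b) (hc' : Odd c)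
    (V : ℕ → Prop) [DecidablePred V] (hV : ¬ V 0) :
    let π := Ideal.Quotient.mk (truncIdeal (truncExponent a b c))
    IsRibbonSystem
      (PowerSeries.map π (signedSeries (2 * (a + b + c)) (fun j => rootAlphabet a b c ζ (j / 2)) V))
      (fun n => if V n then 1 else 0) (π (X 0 ^ a)) (π (X 1 ^ b)) (π (X 2 ^ c)) a b c := by
  intro π
  have sq : ∀ (i : Fin 3) (n : ℕ), truncExponent a b c i = n → 0 < n →
      π (X i ^ n) * π (X i ^ n) = 0 := by
    intro i n hn hn0
    rw [← map_mul, ← pow_add, Ideal.Quotient.eq_zero_iff_mem]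
    exact X_pow_mem_truncIdeal (by omega)
  have sqU := sq 0 a (by simp) ha'.pos
  have sqV := sq 1 b (by simp) hb'.pos
  have sqW := sq 2 c (by simp) hc'.pos
  exact .of_rowSeries π sqU sqV sqW ha'.pos hb'.pos hc'.pos V hV
    (rowSeries_rootAlphabet ha hb hc ha' hb' hc')

/-- The coefficient that detects `p_a p_b p_c`. -/
lemma coeff_signedTotal (ha : IsPrimitiveRoot (ζ a) a) (hb : IsPrimitiveRoot (ζ b) b)
    (hc : IsPrimitiveRoot (ζ c) c) (ha' : Odd a) (hb' : Odd b) (hc' : Odd c)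
    (V : ℕ → Prop) [DecidablePred V] (hV : ¬ V 0) (s : ℕ → ℤ) (hs : ∀ n, s n = if V n then 1 else 0) :
    coeff (truncExponent a b c) (signedTotal (2 * (a + b + c))
      (fun j => rootAlphabet a b c ζ (j / 2)) V (a + b + c)) =
    ((8 * (1 - s a - s b - s c - s (a + b) * (1 - s a - s b) - s (b + c) * (1 - s b - s c) -
        s (a + c) * (1 - s a - s c)) : ℤ) : ℂ) := by
  have h := (isRibbonSystem_rootAlphabet ha hb hc ha' hb' hc' V hV).coeff_total
  have hs' : ∀ n, (if V n then 1 else 0 : MvPowerSeries (Fin 3) ℂ ⧸ truncIdeal (truncExponent a b c))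
    = ((s n : ℤ) : _) := fun n => by rw [hs]; split_ifs <;> simp
  have hpos := ha'.pos
  simp only [hs', PowerSeries.coeff_map, signedSeries, PowerSeries.coeff_mk,
    if_neg (show ¬ (a + b + c = 0) by omega)] at h
  set κ : ℤ := (1 - s a - s b - s c - s (a + b) * (1 - s a - s b) - s (b + c) * (1 - s b - s c) -
        s (a + c) * (1 - s a - s c)) with hκ
  have h2 : Ideal.Quotient.mk (truncIdeal (truncExponent a b c)) (signedTotal (2 * (a + b + c))
      (fun j => rootAlphabet a b c ζ (j / 2)) V (a + b + c)) =
      Ideal.Quotient.mk (truncIdeal (truncExponent a b c))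
        (((8 * κ : ℤ) : MvPowerSeries (Fin 3) ℂ) * (X 0 ^ a * X 1 ^ b * X 2 ^ c)) := by
    rw [h, hκ]
    simp only [map_mul, map_intCast]
    push_cast
    ring
  rw [Ideal.Quotient.eq] at h2
  have h3 := h2 (truncExponent a b c) le_rfl
  rw [map_sub, sub_eq_zero] at h3
  rw [h3, ← map_intCast (C (σ := Fin 3) (R := ℂ)), coeff_C_mul]
  have : (X 0 ^ a * X 1 ^ b * X 2 ^ c : MvPowerSeries (Fin 3) ℂ) =
      monomial (truncExponent a b c) 1 := by
    rw [X_pow_eq, X_pow_eq, X_pow_eq, monomial_mul_monomial, monomial_mul_monomial]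
    simp
  rw [this, coeff_monomial_same, mul_one]

end Specialisation

/-! ### Tableaux of ribbons as words -/

section Words

open scoped ComplexOrder

/-- Words whose `p`-th step is a column step for `p ∈ V` and a row step otherwise. -/
def IsWord (V : ℕ → Prop) {m : ℕ} (w : Fin (m + 1) → ℕ) : Prop :=
  ∀ i : Fin m, V (i + 1) ↔ ¬ RowRel (w i.castSucc) (w i.succ)

open Classical in
/-- The words of length `m + 1` in the letters below `M`. -/
noncomputable def words (M : ℕ) (V : ℕ → Prop) (m : ℕ) : Finset (Fin (m + 1) → ℕ) :=
  (Fintype.piFinset fun _ => Finset.range M).filter (IsWord V)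

lemma mem_words {M : ℕ} {V : ℕ → Prop} {m : ℕ} {w : Fin (m + 1) → ℕ} :
    w ∈ words M V m ↔ (∀ i, w i < M) ∧ IsWord V w := by
  simp [words]

lemma isWord_snoc {V : ℕ → Prop} {m : ℕ} {w : Fin (m + 1) → ℕ} {j : ℕ} :
    IsWord V (Fin.snoc w j : Fin (m + 2) → ℕ) ↔
      IsWord V w ∧ (V (m + 1) ↔ ¬ RowRel (w (Fin.last m)) j) := by
  rw [IsWord, Fin.forall_fin_succ']
  refine and_congr (forall_congr' fun i => ?_) ?_
  · rw [Fin.snoc_castSucc, Fin.succ_castSucc, Fin.snoc_castSucc]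
    rfl
  · rw [Fin.snoc_castSucc, Fin.succ_last, Fin.snoc_last]
    rfl

variable {R : Type*} [CommRing R]

lemma sum_words_last (M : ℕ) (y : ℕ → R) (V : ℕ → Prop) [DecidablePred V] (m j : ℕ) (hj : j < M) :
    ∑ w ∈ words M V m with w (Fin.last m) = j, ∏ i, y (w i) = wordWeight M y V m j := by
  classical
  induction m generalizing j with
  | zero =>
    rw [wordWeight, Finset.sum_eq_single (fun _ => j)]
    · simp
    · intro w hw hne
      refine absurd (funext fun i => ?_) hne
      rw [← (Finset.mem_filter.1 hw).2]
      congr 1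
      exact Fin.ext (by simp)
    · intro h
      have : (fun _ => j) ∈ {w ∈ words M V 0 | w (Fin.last 0) = j} :=
        Finset.mem_filter.2 ⟨mem_words.2 ⟨fun _ => hj, fun i => i.elim0⟩, rfl⟩
      exact absurd this h
  | succ m ih =>
    have step : ∑ w ∈ words M V (m + 1) with w (Fin.last (m + 1)) = j, ∏ i, y (w i) =
        ∑ w ∈ words M V m with (V (m + 1) ↔ ¬ RowRel (w (Fin.last m)) j),
          y j * ∏ i, y (w i) := by
      refine Finset.sum_bij' (fun w _ => Fin.init w) (fun w _ => Fin.snoc w j) ?_ ?_ ?_ ?_ ?_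
      · intro w hw
        obtain ⟨h1, rfl⟩ := Finset.mem_filter.1 hw
        obtain ⟨h2, h3⟩ := mem_words.1 h1
        rw [← Fin.snoc_init_self w, isWord_snoc] at h3
        exact Finset.mem_filter.2 ⟨mem_words.2 ⟨fun i => h2 _, h3.1⟩, h3.2⟩
      · intro w hw
        obtain ⟨h1, h4⟩ := Finset.mem_filter.1 hw
        obtain ⟨h2, h3⟩ := mem_words.1 h1
        refine Finset.mem_filter.2 ⟨mem_words.2 ⟨?_, isWord_snoc.2 ⟨h3, h4⟩⟩, by simp⟩
        rw [Fin.forall_fin_succ']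
        exact ⟨fun i => by simpa using h2 i, by simpa using hj⟩
      · intro w hw
        obtain ⟨h1, rfl⟩ := Finset.mem_filter.1 hw
        exact Fin.snoc_init_self w
      · intro w hw
        exact Fin.init_snoc (α := fun _ => ℕ) _ _
      · intro w hw
        obtain ⟨h1, rfl⟩ := Finset.mem_filter.1 hw
        rw [Fin.prod_univ_castSucc, mul_comm]
        rfl
    rw [step, ← Finset.mul_sum, wordWeight]
    congr 1
    rw [← Finset.sum_fiberwise_of_maps_to (g := fun w => w (Fin.last m))
      (t := Finset.range M) (fun w hw => Finset.mem_range.2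
        ((mem_words.1 (Finset.mem_filter.1 hw).1).1 _)), Finset.sum_filter]
    refine Finset.sum_congr rfl fun i hi => ?_
    rw [← ih i (Finset.mem_range.1 hi), Finset.filter_filter]
    by_cases hV : V (m + 1) <;> by_cases hR : RowRel i j
    all_goals
      simp only [hV, hR, not_true, not_false_iff, if_true, if_false, true_iff, false_iff, not_not]
    · refine Finset.sum_eq_zero fun w hw => ?_
      obtain ⟨-, h1, rfl⟩ := Finset.mem_filter.1 hw
      exact absurd hR h1
    · congr 1
      refine Finset.filter_congr fun w _ => ?_
      exact ⟨fun h => h.2, fun h => ⟨h ▸ hR, h⟩⟩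
    · congr 1
      refine Finset.filter_congr fun w _ => ?_
      exact ⟨fun h => h.2, fun h => ⟨h ▸ hR, h⟩⟩
    · refine Finset.sum_eq_zero fun w hw => ?_
      obtain ⟨-, h1, rfl⟩ := Finset.mem_filter.1 hw
      exact absurd h1 hR

lemma sum_words (M : ℕ) (y : ℕ → R) (V : ℕ → Prop) [DecidablePred V] (m : ℕ) :
    ∑ w ∈ words M V m, ∏ i, y (w i) = ∑ j ∈ Finset.range M, wordWeight M y V m j := by
  rw [← Finset.sum_fiberwise_of_maps_to (g := fun w => w (Fin.last m))
      (t := Finset.range M) (fun w hw => Finset.mem_range.2 ((mem_words.1 hw).1 _))]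
  exact Finset.sum_congr rfl fun j hj => sum_words_last M y V m j (Finset.mem_range.1 hj)

/-- The order isomorphism from letters to natural numbers. -/
def letterCode : Letter ≃ ℕ where
  toFun a := 2 * (ofLex a).1 + (ofLex a).2.toNat
  invFun n := toLex (n / 2, n % 2 = 1)
  left_inv a := by
    obtain ⟨k, b⟩ := a
    change toLex ((2 * k + b.toNat) / 2, decide ((2 * k + b.toNat) % 2 = 1)) = toLex (k, b)
    cases b
    · simp
    · have : (2 * k + 1) / 2 = k := by omega
      simp [this]
  right_inv n := by
    rcases Nat.mod_two_eq_zero_or_one n with h | h <;> simp [h] <;> omega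

lemma letterCode_apply (a : Letter) : letterCode a = 2 * (ofLex a).1 + (ofLex a).2.toNat := rfl

lemma letterCode_div (a : Letter) : letterCode a / 2 = a.index := by
  have := Bool.toNat_le (ofLex a).2
  rw [letterCode_apply, Letter.index]
  omega

lemma unmarked_iff (a : Letter) : a.Unmarked ↔ letterCode a % 2 = 1 := by
  rw [letterCode_apply, Letter.Unmarked]
  cases (ofLex a).2 <;> simp

lemma letterCode_le (a b : Letter) : letterCode a ≤ letterCode b ↔ a ≤ b := by
  rw [Prod.Lex.le_iff, letterCode_apply, letterCode_apply]
  cases (ofLex a).2 <;> cases (ofLex b).2 <;> simp <;> omega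

lemma prod_sum_single {ι : Type*} [Fintype ι] (g : ι → ℕ) (A : ℕ → R) :
    ((∑ i, Finsupp.single (g i) 1 : ℕ →₀ ℕ).prod fun i e => A i ^ e) = ∏ i, A (g i) := by
  rw [← Finsupp.prod_finsetSum_index (fun _ => pow_zero _) (fun _ _ _ => pow_add _ _ _)]
  simp

lemma subst_tableauSeries {τ : Type*} {A : ℕ → MvPowerSeries τ ℂ}
    (hA : MvPowerSeries.HasSubst A) {N : ℕ} (hN : ∀ i, N ≤ i → A i = 0)
    (D : Diagram) {m : ℕ} (e : {b : ℤ × ℤ // b ∈ D} ≃ Fin (m + 1)) (V : ℕ → Prop)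
    [DecidablePred V]
    (h : ∀ T, IsMarkedShiftedTableau D T ↔ IsWord V fun i => letterCode (T (e.symm i))) :
    MvPowerSeries.substAlgHom hA (tableauSeries D) =
      ∑ j ∈ Finset.range (2 * N), wordWeight (2 * N) (fun j => A (j / 2)) V m j := by
  rw [← sum_words, subst_counting hA (IsWord V (m := m))
    (fun w => ∑ i, Finsupp.single (w i / 2) 1) _ ?_ (words (2 * N) V m)
    (fun w hw => (mem_words.1 hw).2) ?_]
  · exact Finset.sum_congr rfl fun w _ => prod_sum_single _ _
  · intro d
    change ((tableaux D d).ncard : ℚ) = _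
    congr 1
    let E : ({b : ℤ × ℤ // b ∈ D} → Letter) ≃ (Fin (m + 1) → ℕ) := e.arrowCongr letterCode
    rw [← Set.ncard_image_of_injective _ E.injective]
    congr 1
    have hE : ∀ T i, E T i = letterCode (T (e.symm i)) := fun T i => rfl
    have hc : ∀ T, ∑ i, Finsupp.single (E T i / 2) 1 = content D T := by
      intro T
      simp only [hE, letterCode_div, content]
      exact e.symm.sum_comp (fun b => Finsupp.single (T b).index 1)
    ext w
    constructor
    · rintro ⟨T, ⟨h1, h2⟩, rfl⟩
      exact ⟨(h T).1 h1, (hc T).trans h2⟩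
    · rintro ⟨h1, h2⟩
      refine ⟨E.symm w, ⟨(h _).2 ?_, ?_⟩, E.apply_symm_apply w⟩
      · have : (fun i => letterCode (E.symm w (e.symm i))) = w := E.apply_symm_apply w
        rw [this]
        exact h1
      · rw [← hc, E.apply_symm_apply]
        exact h2
  · intro w hw hw'
    rw [prod_sum_single]
    obtain ⟨i, hi⟩ : ∃ i, ¬ w i < 2 * N := by
      by_contra hcon
      push Not at hcon
      exact hw' (mem_words.2 ⟨hcon, hw⟩)
    exact Finset.prod_eq_zero (Finset.mem_univ i) (hN _ (by omega))

/-! ### Ribbons described by the row of the box of each content -/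

/-- The box of content `c + x` in row `r x`. -/
def ribbonBox (r : ℕ → ℤ) (c : ℤ) (x : ℕ) : ℤ × ℤ := (r x, r x + c + x)

/-- The column steps. -/
def ColStep (r : ℕ → ℤ) (p : ℕ) : Prop := p ≠ 0 ∧ r p ≠ r (p - 1)

lemma ribbonBox_injective (r : ℕ → ℤ) (c : ℤ) : Function.Injective (ribbonBox r c) := by
  intro x y h
  simp only [ribbonBox, Prod.mk.injEq] at h
  omega

lemma row_chain {r : ℕ → ℤ} {m : ℕ} (hr : ∀ p < m, r (p + 1) = r p ∨ r (p + 1) = r p - 1)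
    {t : ℕ → ℕ} (ht : ∀ p < m, r (p + 1) ≠ r p ↔ ¬ RowRel (t p) (t (p + 1))) (x d : ℕ)
    (hd : x + d ≤ m) : r (x + d) ≤ r x ∧ (r (x + d) = r x →
      t x ≤ t (x + d) ∧ (0 < d → t x = t (x + d) → t x % 2 = 1)) := by
  induction d with
  | zero => simp
  | succ d ih =>
    have h1 := hr (x + d) (by omega)
    have h2 := ht (x + d) (by omega)
    have h3 := ih (by omega)
    rw [← Nat.add_assoc]
    refine ⟨by omega, fun h => ?_⟩
    have h4 : r (x + d) = r x := by omega
    have h5 := h3.2 h4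
    rw [RowRel] at h2
    omega

lemma col_chain {r : ℕ → ℤ} {m : ℕ} (hr : ∀ p < m, r (p + 1) = r p ∨ r (p + 1) = r p - 1)
    {t : ℕ → ℕ} (ht : ∀ p < m, r (p + 1) ≠ r p ↔ ¬ RowRel (t p) (t (p + 1))) (x d : ℕ)
    (hd : x + d ≤ m) : r x ≤ r (x + d) + d ∧ (r (x + d) + d = r x →
      t (x + d) ≤ t x ∧ (0 < d → t x = t (x + d) → t x % 2 = 0)) := by
  induction d with
  | zero => simp
  | succ d ih =>
    have h1 := hr (x + d) (by omega)
    have h2 := ht (x + d) (by omega)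
    have h3 := ih (by omega)
    rw [← Nat.add_assoc]
    push_cast
    refine ⟨by omega, fun h => ?_⟩
    have h4 : r (x + d) + d = r x := by omega
    have h5 := h3.2 h4
    rw [RowRel] at h2
    omega

/-- The boxes of a ribbon in the order of their contents. -/
noncomputable def ribbonEquiv {D : Diagram} {r : ℕ → ℤ} {c : ℤ} {m : ℕ}
    (hD : D = (Finset.range (m + 1)).image (ribbonBox r c)) :
    Fin (m + 1) ≃ {b : ℤ × ℤ // b ∈ D} :=
  Equiv.ofBijective
    (fun i => ⟨ribbonBox r c i, hD ▸ Finset.mem_image_of_mem _ (Finset.mem_range.2 i.2)⟩) <| by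
    constructor
    · intro i j h
      exact Fin.ext (ribbonBox_injective r c (Subtype.ext_iff.1 h))
    · rintro ⟨b, hb⟩
      subst hD
      obtain ⟨x, hx, rfl⟩ := Finset.mem_image.1 hb
      exact ⟨⟨x, Finset.mem_range.1 hx⟩, rfl⟩

lemma isMarkedShiftedTableau_iff_isWord {D : Diagram} {r : ℕ → ℤ} {c : ℤ} {m : ℕ}
    (hD : D = (Finset.range (m + 1)).image (ribbonBox r c))
    (hr : ∀ p < m, r (p + 1) = r p ∨ r (p + 1) = r p - 1)
    (T : {b : ℤ × ℤ // b ∈ D} → Letter) :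
    IsMarkedShiftedTableau D T ↔
      IsWord (ColStep r) fun i => letterCode (T (ribbonEquiv hD i)) := by
  have val : ∀ i, (ribbonEquiv hD i).1 = (r i, r i + c + (i : ℕ)) := fun i => rfl
  constructor
  · intro h i
    have v1 := val i.castSucc
    have v2 := val i.succ
    simp only [Fin.val_castSucc, Fin.val_succ] at v1 v2
    set a := ribbonEquiv hD i.castSucc
    set b := ribbonEquiv hD i.succ
    have hab : a ≠ b := fun h => by
      have := (ribbonEquiv hD).injective h
      simp [Fin.ext_iff] at this
    change ColStep r (i + 1) ↔ ¬ RowRel (letterCode (T a)) (letterCode (T b))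
    rw [ColStep, RowRel, Nat.add_sub_cancel]
    rcases hr i i.2 with h1 | h1
    · have h2 := h.row_le a b (by rw [v1, v2, h1]) (by rw [v1, v2, h1]; simp)
      have h3 := h.row_marked a b (by rw [v1, v2, h1])
      rw [← letterCode_le] at h2
      rw [← letterCode.injective.eq_iff, unmarked_iff] at h3
      have h4 : ¬ (letterCode (T a) = letterCode (T b) ∧ ¬ letterCode (T a) % 2 = 1) :=
        fun h => hab (h3 h.1 h.2)
      omega
    · have h2 := h.col_le b a (by rw [v1, v2, h1]; push_cast; ring) (by rw [v1, v2, h1]; simp)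
      have h3 := h.col_unmarked a b (by rw [v1, v2, h1]; push_cast; ring)
      rw [← letterCode_le] at h2
      rw [← letterCode.injective.eq_iff, unmarked_iff] at h3
      have h4 : ¬ (letterCode (T a) = letterCode (T b) ∧ letterCode (T a) % 2 = 1) :=
        fun h => hab (h3 h.1 h.2)
      omega
  · intro h
    set t : ℕ → ℕ := fun x =>
      if hx : x < m + 1 then letterCode (T (ribbonEquiv hD ⟨x, hx⟩)) else 0 with ht
    have hT : ∀ i, letterCode (T (ribbonEquiv hD i)) = t i := fun i => by
      simp only [ht]
      rw [dif_pos i.2]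
    have hstep : ∀ p < m, r (p + 1) ≠ r p ↔ ¬ RowRel (t p) (t (p + 1)) := by
      intro p hp
      have := h ⟨p, hp⟩
      simp only [hT, ColStep] at this
      simpa using this
    have row : ∀ i j : Fin (m + 1), r i = r j → (i : ℕ) ≤ j → t i ≤ t j ∧
        ((i : ℕ) < j → t i = t j → t i % 2 = 1) := by
      intro i j h1 h2
      have := (row_chain hr hstep i (j - i) (by omega)).2
      rw [Nat.add_sub_cancel' h2] at this
      exact ⟨(this h1.symm).1, fun h3 => (this h1.symm).2 (by omega)⟩
    have col : ∀ i j : Fin (m + 1), r i + i = r j + j → (i : ℕ) ≤ j → t j ≤ t i ∧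
        ((i : ℕ) < j → t i = t j → t i % 2 = 0) := by
      intro i j h1 h2
      have := (col_chain hr hstep i (j - i) (by omega)).2
      rw [Nat.add_sub_cancel' h2] at this
      have h4 : r j + ((j - i : ℕ) : ℤ) = r i := by omega
      exact ⟨(this h4).1, fun h3 => (this h4).2 (by omega)⟩
    refine ⟨?_, ?_, ?_, ?_⟩
    all_goals
      intro a b
      obtain ⟨i, rfl⟩ := (ribbonEquiv hD).surjective a
      obtain ⟨j, rfl⟩ := (ribbonEquiv hD).surjective b
      rw [val, val]
      intro h1 h2
      dsimp only at h1
    · dsimp only at h2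
      rw [← letterCode_le, hT, hT]
      exact (row i j h1 (by omega)).1
    · dsimp only at h2
      rw [← letterCode_le, hT, hT]
      exact (col j i (by omega) (by omega)).1
    · rw [unmarked_iff, hT]
      rw [← letterCode.injective.eq_iff, hT, hT] at h2
      intro h3
      congr 1
      rcases lt_trichotomy i j with h4 | h4 | h4
      · have := (col i j (by omega) h4.le).2 h4 h2
        omega
      · exact h4
      · have := (col j i (by omega) h4.le).2 h4 h2.symm
        omega
    · rw [unmarked_iff, hT]
      rw [← letterCode.injective.eq_iff, hT, hT] at h2
      intro h3
      congr 1
      rcases lt_trichotomy i j with h4 | h4 | h4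
      · have := (row i j h1 h4.le).2 h4 h2
        omega
      · exact h4
      · have := (row j i h1.symm h4.le).2 h4 h2.symm
        omega

/-- A ribbon with an even number of column steps whose tableau series is `p`-positive has
nonnegative coefficient at every `p_a p_b p_c`. -/
lemma nonneg_of_isPPositive {D : Diagram} {r : ℕ → ℤ} {q : ℤ} {m : ℕ}
    (hD : D = (Finset.range (m + 1)).image (ribbonBox r q))
    (hr : ∀ p < m, r (p + 1) = r p ∨ r (p + 1) = r p - 1) (heven : Even (r 0 - r m))
    (hpos : IsPPositive (tableauSeries D)) {a b c : ℕ} (habc : a + b + c = m + 1)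
    (ha : Odd a) (hb : Odd b) (hc : Odd c) (s : ℕ → ℤ)
    (hs : ∀ p ≤ m, s p = if p ≠ 0 ∧ r p ≠ r (p - 1) then 1 else 0) :
    0 ≤ 1 - s a - s b - s c - s (a + b) * (1 - s a - s b) - s (b + c) * (1 - s b - s c) -
        s (a + c) * (1 - s a - s c) := by
  classical
  obtain ⟨ζ, hζ⟩ : ∃ ζ : ℕ → ℂ, ∀ n, n ≠ 0 → IsPrimitiveRoot (ζ n) n :=
    ⟨_, fun n hn => Complex.isPrimitiveRoot_exp n hn⟩
  have pa := hζ a ha.pos.ne'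
  have pb := hζ b hb.pos.ne'
  have pc := hζ c hc.pos.ne'
  have h1 := hpos.nonnegCoeff_subst pa pb pc (truncExponent a b c)
  rw [subst_tableauSeries (hasSubst_rootAlphabet a b c ζ)
    (fun i hi => rootAlphabet_eq_zero a b c ζ hi) D (ribbonEquiv hD).symm (ColStep r)
    (isMarkedShiftedTableau_iff_isWord hD hr)] at h1
  have hsign : ∀ n ≤ m, (∏ p ∈ Finset.range n,
      if ColStep r (p + 1) then (-1 : MvPowerSeries (Fin 3) ℂ) else 1) =
      ((-1 : ℤˣ) ^ (r 0 - r n) : ℤˣ) := by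
    intro n
    induction n with
    | zero => simp
    | succ n ih =>
      intro hn
      rw [Finset.prod_range_succ, ih (by omega)]
      rcases hr n (by omega) with h | h
      · simp [ColStep, h]
      · have : r 0 - (r n - 1) = (r 0 - r n) + 1 := by ring
        simp [ColStep, h, this, zpow_add]
  have hsig : signedTotal (2 * (a + b + c)) (fun j => rootAlphabet a b c ζ (j / 2)) (ColStep r)
      (a + b + c) = ∑ j ∈ Finset.range (2 * (a + b + c)),
        wordWeight (2 * (a + b + c)) (fun j => rootAlphabet a b c ζ (j / 2)) (ColStep r) m j := by
    rw [signedTotal, habc, Nat.add_sub_cancel, hsign m le_rfl, heven.neg_one_zpow]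
    simp
  have key := coeff_signedTotal pa pb pc ha hb hc (ColStep r) (by simp [ColStep])
    (fun n => if ColStep r n then 1 else 0) fun _ => rfl
  rw [hsig] at key
  rw [key] at h1
  have h2 := Int.cast_nonneg_iff.1 h1
  have e : ∀ p ≤ m, s p = if ColStep r p then 1 else 0 := fun p hp => by
    rw [hs p hp]
    exact if_congr Iff.rfl rfl rfl
  have := ha.pos
  have := hb.pos
  have := hc.pos
  rw [e a (by omega), e b (by omega), e c (by omega), e (a + b) (by omega), e (b + c) (by omega),
    e (a + c) (by omega)]
  linarith

end Words

/-! ### The shape of a ribbon -/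

section Shape

/-- The rows of `D` are numbered `i₀, …, i₀ + ℓ - 1`, and the contents of the boxes in row `i₀ + t`
fill the interval `[β (t + 1), β t)`. -/
structure IsRowBounds (D : Diagram) (i₀ ℓ : ℕ) (β : ℕ → ℕ) : Prop where
  pos : 0 < ℓ
  lt : ∀ t < ℓ, β (t + 1) < β t
  mem : ∀ b, b ∈ D ↔ ∃ t < ℓ, ∃ x : ℕ, β (t + 1) ≤ x ∧ x < β t ∧
    b = ((i₀ : ℤ) + t, (i₀ : ℤ) + t + x)

lemma mem_shiftedSkewDiagram {lam mu : List ℕ} {b : ℤ × ℤ} :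
    b ∈ shiftedSkewDiagram lam mu ↔
      ∃ i x : ℕ, mu.getD i 0 ≤ x ∧ x < lam.getD i 0 ∧ b = ((i : ℤ), (i : ℤ) + x) := by
  simp only [shiftedSkewDiagram, Finset.mem_biUnion, Finset.mem_range, Finset.mem_image,
    Finset.mem_Ico]
  constructor
  · rintro ⟨i, -, j, ⟨h1, h2⟩, rfl⟩
    refine ⟨i, j - i, by omega, by omega, ?_⟩
    rw [Prod.mk.injEq]
    omega
  · rintro ⟨i, x, h1, h2, rfl⟩
    refine ⟨i, ?_, i + x, by omega, by push_cast; rfl⟩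
    by_contra h
    rw [List.getD_eq_default _ _ (by omega)] at h2
    omega

lemma IsStrictPartition.getD_succ_le {l : List ℕ} (h : IsStrictPartition l) (i : ℕ) :
    l.getD (i + 1) 0 ≤ l.getD i 0 := by
  by_cases hi : i + 1 < l.length
  · have := List.pairwise_iff_getElem.1 h.1 i (i + 1) (by omega) hi (by omega)
    rw [List.getD_eq_getElem _ _ hi, List.getD_eq_getElem _ _ (by omega)]
    omega
  · rw [List.getD_eq_default _ _ (by omega)]
    omega

lemma exists_crossing {D : Diagram} {a b : ℤ × ℤ} {i : ℤ}
    (h : Relation.ReflTransGen (fun x y => x ∈ D ∧ y ∈ D ∧ Diagram.Adjacent x y) a b)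
    (ha : a.1 ≤ i) (hb : i < b.1) : ∃ j, (i, j) ∈ D ∧ (i + 1, j) ∈ D := by
  induction h with
  | refl => omega
  | @tail c d _ hcd ih =>
    by_cases hc : i < c.1
    · exact ih hc
    · obtain ⟨h1, h2, h3⟩ := hcd
      rw [Diagram.Adjacent] at h3
      obtain ⟨c1, c2⟩ := c
      obtain ⟨d1, d2⟩ := d
      dsimp only at *
      obtain rfl : c1 = i := by omega
      obtain rfl : d1 = c1 + 1 := by omega
      obtain rfl : d2 = c2 := by omega
      exact ⟨_, h1, h2⟩

lemma exists_isRowBounds {lam mu : List ℕ}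
    (hmu : IsStrictPartition mu) (hconn : (shiftedSkewDiagram lam mu).IsConnected)
    (hrib : (shiftedSkewDiagram lam mu).IsRibbon) :
    ∃ i₀ ℓ β, IsRowBounds (shiftedSkewDiagram lam mu) i₀ ℓ β := by
  classical
  set D := shiftedSkewDiagram lam mu with hD
  have hmem : ∀ b, b ∈ D ↔ _ := fun b => mem_shiftedSkewDiagram
  set L := fun i => lam.getD i 0 with hL
  set M := fun i => mu.getD i 0 with hM
  have hmem' : ∀ i x : ℕ, ((i : ℤ), (i : ℤ) + x) ∈ D ↔ M i ≤ x ∧ x < L i := by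
    intro i x
    rw [hmem]
    constructor
    · rintro ⟨i', x', h1, h2, h3⟩
      rw [Prod.mk.injEq] at h3
      obtain rfl : i = i' := by omega
      obtain rfl : x = x' := by omega
      exact ⟨h1, h2⟩
    · rintro ⟨h1, h2⟩
      exact ⟨i, x, h1, h2, rfl⟩
  obtain ⟨⟨b, hb⟩, hpath⟩ := hconn
  obtain ⟨i, x, h1, h2, -⟩ := (hmem b).1 hb
  have hlen : ∀ i, M i < L i → i < lam.length := by
    intro i hi
    by_contra h
    have : L i = 0 := List.getD_eq_default _ _ (by omega)
    omega
  have hex : ∃ i, M i < L i := ⟨i, lt_of_le_of_lt h1 h2⟩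
  set i₀ := Nat.find hex with hi₀
  set i₁ := Nat.findGreatest (fun i => M i < L i) lam.length with hi₁
  have hmin : ∀ i, M i < L i → i₀ ≤ i := fun i hi => Nat.find_min' hex hi
  have hmax : ∀ i, M i < L i → i ≤ i₁ := fun i hi => Nat.le_findGreatest (hlen i hi).le hi
  have h₀ : M i₀ < L i₀ := Nat.find_spec hex
  have h₁ : M i₁ < L i₁ := Nat.findGreatest_spec (P := fun i => M i < L i) (hlen i₀ h₀).le h₀
  have hcross : ∀ i, i₀ ≤ i → i < i₁ → M i < L i ∧ M (i + 1) < L (i + 1) ∧ L (i + 1) = M i := by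
    intro i hi hi'
    obtain ⟨j, hj, hj'⟩ := exists_crossing (i := i)
      (hpath _ ((hmem' i₀ (M i₀)).2 ⟨le_rfl, h₀⟩) _ ((hmem' i₁ (M i₁)).2 ⟨le_rfl, h₁⟩))
      (by dsimp only; omega) (by dsimp only; omega)
    obtain ⟨x, rfl⟩ : ∃ x : ℕ, j = (i : ℤ) + x := by
      obtain ⟨i', x', -, -, h⟩ := (hmem _).1 hj
      rw [Prod.mk.injEq] at h
      exact ⟨x', by omega⟩
    obtain ⟨y, hy⟩ : ∃ y : ℕ, (i : ℤ) + x = ((i + 1 : ℕ) : ℤ) + y := by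
      obtain ⟨i', x', -, -, h⟩ := (hmem _).1 hj'
      rw [Prod.mk.injEq] at h
      exact ⟨x', by omega⟩
    have g1 := (hmem' i x).1 hj
    have g2 := (hmem' (i + 1) y).1 (by rw [← hy]; exact_mod_cast hj')
    refine ⟨by omega, by omega, le_antisymm ?_ (by omega)⟩
    by_contra hcon
    have g3 : M (i + 1) ≤ M i := hmu.getD_succ_le i
    have g4 := (hmem' (i + 1) (M i)).2 ⟨g3, by omega⟩
    refine hrib _ g4 ?_
    have g5 := (hmem' i (M i)).2 ⟨le_rfl, by omega⟩
    convert g5 using 2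
    · push_cast; ring
    · push_cast; ring
  have hle := hmin i₁ h₁
  have hrow : ∀ i, i₀ ≤ i → i ≤ i₁ → M i < L i := by
    intro i hi hi'
    rcases hi'.lt_or_eq with h | rfl
    · exact (hcross i hi h).1
    · exact h₁
  set β : ℕ → ℕ := fun t => if t = 0 then L i₀ else M (i₀ + t - 1) with hβ
  have hβM : ∀ t, β (t + 1) = M (i₀ + t) := fun t => by simp [hβ, ← add_assoc]
  have hβL : ∀ t, i₀ + t ≤ i₁ → β t = L (i₀ + t) := by
    intro t ht
    cases t with
    | zero => rfl
    | succ t =>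
      rw [hβM, ← add_assoc]
      exact (hcross (i₀ + t) (by omega) (by omega)).2.2.symm
  refine ⟨i₀, i₁ - i₀ + 1, β, by omega, ?_, ?_⟩
  · intro t ht
    rw [hβM, hβL t (by omega)]
    exact hrow _ (by omega) (by omega)
  · intro b
    rw [hmem]
    constructor
    · rintro ⟨i, x, g1, g2, rfl⟩
      have g3 := hmin i (lt_of_le_of_lt g1 g2)
      have g4 := hmax i (lt_of_le_of_lt g1 g2)
      obtain ⟨t, rfl⟩ := Nat.exists_eq_add_of_le g3
      exact ⟨t, by omega, x, by rw [hβM]; exact g1, by rw [hβL t g4]; exact g2, by push_cast; rfl⟩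
    · rintro ⟨t, ht, x, g1, g2, rfl⟩
      rw [hβM] at g1
      rw [hβL t (by omega)] at g2
      exact ⟨i₀ + t, x, g1, g2, by push_cast; rfl⟩

namespace IsRowBounds

variable {D : Diagram} {i₀ ℓ : ℕ} {β : ℕ → ℕ}

lemma add_le (h : IsRowBounds D i₀ ℓ β) (t d : ℕ) (hd : t + d ≤ ℓ) : β (t + d) + d ≤ β t := by
  induction d with
  | zero => simp
  | succ d ih =>
    have := h.lt (t + d) (by omega)
    have := ih (by omega)
    change β (t + d + 1) + (d + 1) ≤ β t
    omega

lemma le_of_le (h : IsRowBounds D i₀ ℓ β) {t u : ℕ} (htu : t ≤ u) (hu : u ≤ ℓ) :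
    β u + (u - t) ≤ β t := by
  have := h.add_le t (u - t) (by omega)
  rwa [Nat.add_sub_cancel' htu] at this

lemma image_fst (h : IsRowBounds D i₀ ℓ β) :
    D.image Prod.fst = ((List.range ℓ).map fun t : ℕ => (i₀ : ℤ) + t).toFinset := by
  ext i
  simp only [Finset.mem_image, List.mem_toFinset, List.mem_map, List.mem_range]
  constructor
  · rintro ⟨b, hb, rfl⟩
    obtain ⟨t, ht, x, -, -, rfl⟩ := (h.mem b).1 hb
    exact ⟨t, ht, rfl⟩
  · rintro ⟨t, ht, rfl⟩
    exact ⟨_, (h.mem _).2 ⟨t, ht, β (t + 1), le_rfl, h.lt t ht, rfl⟩, rfl⟩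

lemma card_row (h : IsRowBounds D i₀ ℓ β) {t : ℕ} (ht : t < ℓ) :
    (D.filter fun b => b.1 = (i₀ : ℤ) + t).card = β t - β (t + 1) := by
  have : (D.filter fun b => b.1 = (i₀ : ℤ) + t) =
      (Finset.Ico (β (t + 1)) (β t)).image fun x : ℕ => ((i₀ : ℤ) + t, (i₀ : ℤ) + t + x) := by
    ext b
    simp only [Finset.mem_filter, h.mem, Finset.mem_image, Finset.mem_Ico]
    constructor
    · rintro ⟨⟨u, hu, x, h1, h2, rfl⟩, h3⟩
      obtain rfl : u = t := by dsimp only at h3; omega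
      exact ⟨x, ⟨h1, h2⟩, rfl⟩
    · rintro ⟨x, ⟨h1, h2⟩, rfl⟩
      exact ⟨⟨t, ht, x, h1, h2, rfl⟩, rfl⟩
  rw [this, Finset.card_image_of_injective, Nat.card_Ico]
  intro x y hxy
  simpa using hxy

lemma rowSizes_eq (h : IsRowBounds D i₀ ℓ β) :
    D.rowSizes = (List.range ℓ).map fun t => β t - β (t + 1) := by
  have hnd : ((List.range ℓ).map fun t : ℕ => (i₀ : ℤ) + t).Nodup :=
    List.nodup_range.map fun x y hxy => by simpa using hxy
  have hsort : (D.image Prod.fst).sort (· ≤ ·) = (List.range ℓ).map fun t : ℕ => (i₀ : ℤ) + t := by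
    rw [h.image_fst, List.toFinset_sort _ hnd, List.pairwise_map]
    exact List.pairwise_lt_range.imp fun hab => by omega
  rw [Diagram.rowSizes, hsort, List.map_map]
  refine List.map_congr_left fun t ht => ?_
  exact h.card_row (List.mem_range.1 ht)

lemma length_eq (h : IsRowBounds D i₀ ℓ β) : D.length = ℓ := by
  rw [Diagram.length, h.rowSizes_eq, List.length_map, List.length_range]

lemma firstRow_eq (h : IsRowBounds D i₀ ℓ β) : D.firstRow = β 0 - β 1 := by
  have := h.pos
  obtain ⟨n, rfl⟩ : ∃ n, ℓ = n + 1 := ⟨ℓ - 1, by omega⟩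
  rw [Diagram.firstRow, h.rowSizes_eq, List.range_succ_eq_map]
  rfl

lemma lastRow_eq (h : IsRowBounds D i₀ ℓ β) : D.lastRow = β (ℓ - 1) - β ℓ := by
  have := h.pos
  obtain ⟨n, rfl⟩ : ∃ n, ℓ = n + 1 := ⟨ℓ - 1, by omega⟩
  rw [Diagram.lastRow, h.rowSizes_eq, List.range_succ]
  simp

/-- The row, counted from `0`, of the box of content `x`. -/
def rowIndex (ℓ : ℕ) (β : ℕ → ℕ) (x : ℕ) : ℕ :=
  Nat.findGreatest (fun t => β ℓ + x < β t) (ℓ - 1)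

lemma rowIndex_spec (h : IsRowBounds D i₀ ℓ β) {x : ℕ} (hx : β ℓ + x < β 0) :
    rowIndex ℓ β x < ℓ ∧ β (rowIndex ℓ β x + 1) ≤ β ℓ + x ∧ β ℓ + x < β (rowIndex ℓ β x) := by
  have h1 : rowIndex ℓ β x ≤ ℓ - 1 := Nat.findGreatest_le _
  have h2 := h.pos
  refine ⟨by omega, ?_, Nat.findGreatest_spec (P := fun t => β ℓ + x < β t) (Nat.zero_le _) hx⟩
  by_cases h3 : rowIndex ℓ β x = ℓ - 1
  · rw [h3, Nat.sub_add_cancel h2]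
    omega
  · exact not_lt.1 (Nat.findGreatest_is_greatest (P := fun t => β ℓ + x < β t)
      (Nat.lt_succ_self (rowIndex ℓ β x)) (by omega))

lemma rowIndex_unique (h : IsRowBounds D i₀ ℓ β) {y t u : ℕ} (ht : t < ℓ) (hu : u < ℓ)
    (h1 : β (t + 1) ≤ y) (h2 : y < β t) (h3 : β (u + 1) ≤ y) (h4 : y < β u) : t = u := by
  rcases lt_trichotomy t u with h5 | h5 | h5
  · have := h.le_of_le (t := t + 1) (u := u) h5 hu.le
    omega
  · exact h5
  · have := h.le_of_le (t := u + 1) (u := t) h5 ht.le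
    omega

lemma eq_image (h : IsRowBounds D i₀ ℓ β) {m : ℕ} (hm : β 0 = β ℓ + (m + 1)) :
    D = (Finset.range (m + 1)).image
      (ribbonBox (fun x => (i₀ : ℤ) + rowIndex ℓ β x) (β ℓ)) := by
  ext b
  rw [h.mem, Finset.mem_image]
  constructor
  · rintro ⟨t, ht, x, h1, h2, rfl⟩
    have h3 := h.le_of_le (t := t + 1) (u := ℓ) (by omega) le_rfl
    have h4 := h.le_of_le (t := 0) (u := t) (by omega) ht.le
    obtain ⟨y, rfl⟩ := Nat.exists_eq_add_of_le (show β ℓ ≤ x by omega)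
    have hy := h.rowIndex_spec (x := y) (by omega)
    have := h.rowIndex_unique ht hy.1 h1 h2 hy.2.1 hy.2.2
    refine ⟨y, Finset.mem_range.2 (by omega), ?_⟩
    rw [ribbonBox, ← this, Prod.mk.injEq]
    push_cast
    exact ⟨rfl, by ring⟩
  · rintro ⟨y, hy, rfl⟩
    rw [Finset.mem_range] at hy
    have h1 := h.rowIndex_spec (x := y) (by omega)
    refine ⟨_, h1.1, β ℓ + y, h1.2.1, h1.2.2, ?_⟩
    rw [ribbonBox, Prod.mk.injEq]
    push_cast
    exact ⟨rfl, by ring⟩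

lemma card_eq (h : IsRowBounds D i₀ ℓ β) : D.card = β 0 - β ℓ := by
  have h1 := h.le_of_le (Nat.zero_le ℓ) le_rfl
  have h2 := h.pos
  obtain ⟨m, hm⟩ : ∃ m, β 0 = β ℓ + (m + 1) := ⟨β 0 - β ℓ - 1, by omega⟩
  rw [h.eq_image hm, Finset.card_image_of_injective _ (ribbonBox_injective _ _), Finset.card_range]
  omega

lemma rowIndex_succ (h : IsRowBounds D i₀ ℓ β) {x : ℕ} (hx : β ℓ + (x + 1) < β 0) :
    (rowIndex ℓ β (x + 1) = rowIndex ℓ β x ∧ ∀ t, t < ℓ → β t ≠ β ℓ + (x + 1)) ∨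
    (rowIndex ℓ β (x + 1) + 1 = rowIndex ℓ β x ∧ 0 < rowIndex ℓ β x ∧
      β (rowIndex ℓ β x) = β ℓ + (x + 1)) := by
  obtain ⟨h1, h2, h3⟩ := h.rowIndex_spec (x := x) (by omega)
  obtain ⟨h4, h5, h6⟩ := h.rowIndex_spec (x := x + 1) hx
  generalize rowIndex ℓ β x = t at *
  generalize rowIndex ℓ β (x + 1) = u at *
  by_cases h7 : β ℓ + (x + 1) < β t
  · left
    have h8 := h.rowIndex_unique h4 h1 h5 h6 (by omega) h7
    refine ⟨h8, fun v hv hv' => ?_⟩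
    rcases lt_or_ge t v with h9 | h9
    · have := h.le_of_le (t := t + 1) (u := v) h9 hv.le
      omega
    · have := h.le_of_le (t := v) (u := t) h9 h1.le
      omega
  · right
    have h8 : 0 < t := by
      by_contra h9
      obtain rfl : t = 0 := by omega
      omega
    refine ⟨?_, h8, by omega⟩
    have h9 := h.lt (t - 1) (by omega)
    have h10 : t - 1 + 1 = t := by omega
    rw [h10] at h9
    have := h.rowIndex_unique h4 (u := t - 1) (by omega) h5 h6 (by rw [h10]; omega) (by omega)
    omega

open Classical in
/-- The indicator function of the column steps, in terms of the row bounds. -/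
noncomputable def stepIndicator (ℓ : ℕ) (β : ℕ → ℕ) (p : ℕ) : ℤ :=
  if ∃ t, 0 < t ∧ t < ℓ ∧ β t = β ℓ + p then 1 else 0

lemma stepIndicator_eq_one {p t : ℕ} (h0 : 0 < t) (h1 : t < ℓ) (h2 : β t = β ℓ + p) :
    stepIndicator ℓ β p = 1 := if_pos ⟨t, h0, h1, h2⟩

lemma stepIndicator_eq_zero {p : ℕ} (h : ∀ t, 0 < t → t < ℓ → β t ≠ β ℓ + p) :
    stepIndicator ℓ β p = 0 := if_neg fun ⟨t, h0, h1, h2⟩ => h t h0 h1 h2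

lemma stepIndicator_cases (ℓ : ℕ) (β : ℕ → ℕ) (p : ℕ) :
    stepIndicator ℓ β p = 0 ∨ stepIndicator ℓ β p = 1 := by
  rw [stepIndicator]
  split_ifs <;> simp

lemma nonneg_of_isPPositive (h : IsRowBounds D i₀ ℓ β) (hodd : Odd ℓ)
    (hpos : IsPPositive (tableauSeries D)) {a b c : ℕ} (habc : β 0 = β ℓ + (a + b + c))
    (ha : Odd a) (hb : Odd b) (hc : Odd c) {s : ℕ → ℤ} (hs : s = stepIndicator ℓ β) :
    0 ≤ 1 - s a - s b - s c - s (a + b) * (1 - s a - s b) - s (b + c) * (1 - s b - s c) -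
        s (a + c) * (1 - s a - s c) := by
  have ha' := ha.pos
  obtain ⟨m, hm⟩ : ∃ m, a + b + c = m + 1 := ⟨a + b + c - 1, by omega⟩
  rw [hm] at habc
  refine _root_.nonneg_of_isPPositive (h.eq_image habc) ?_ ?_ hpos hm ha hb hc s ?_
  · intro p hp
    have := h.rowIndex_succ (x := p) (by omega)
    omega
  · obtain ⟨h1, h2, h3⟩ := h.rowIndex_spec (x := 0) (by omega)
    obtain ⟨h4, h5, h6⟩ := h.rowIndex_spec (x := m) (by omega)
    have h7 := h.lt (ℓ - 1) (by omega)
    rw [Nat.sub_add_cancel h.pos] at h7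
    have h8 := h.rowIndex_unique h1 (u := ℓ - 1) (by omega) h2 h3
      (by rw [Nat.sub_add_cancel h.pos]; omega) (by omega)
    have h10 := h.lt 0 h.pos
    have h9 := h.rowIndex_unique h4 (u := 0) h.pos h5 h6 (by omega) (by omega)
    rw [h8, h9]
    obtain ⟨q, hq⟩ := hodd
    exact ⟨q, by push_cast; omega⟩
  · intro p hp
    rw [hs]
    cases p with
    | zero =>
      rw [if_neg (by simp)]
      refine stepIndicator_eq_zero fun t _ ht h1 => ?_
      have := h.le_of_le ht.le le_rfl
      omega
    | succ p =>
      have h0 := h.le_of_le (Nat.zero_le ℓ) le_rfl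
      rcases h.rowIndex_succ (x := p) (by omega) with h1 | h1
      · rw [if_neg (by simp [h1.1]), stepIndicator_eq_zero fun t _ ht => h1.2 t ht]
      · have h2 := h.rowIndex_spec (x := p) (by omega)
        rw [if_pos ⟨by omega, by rw [Nat.add_sub_cancel]; omega⟩,
          stepIndicator_eq_one h1.2.1 h2.1 h1.2.2]

lemma headLength_spec (h : IsRowBounds D i₀ ℓ β) {j : ℕ} (hj : D.headLength = j + 1) :
    j ≤ ℓ ∧ (∀ t < j, β t = β (t + 1) + 1) ∧ (j < ℓ → β (j + 1) + 2 ≤ β j) := by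
  rw [Diagram.headLength, h.rowSizes_eq, Nat.add_right_cancel_iff] at hj
  have hlen : ((List.range ℓ).map fun t => β t - β (t + 1)).length = ℓ := by simp
  have hle : j ≤ ℓ := by
    rw [← hj]
    exact List.findIdx_le_length.trans_eq hlen
  refine ⟨hle, fun t ht => ?_, fun hlt => ?_⟩
  · have h1 := List.not_of_lt_findIdx (hj ▸ ht)
    have h2 := h.lt t (by omega)
    simp at h1
    omega
  · have h1 := List.findIdx_getElem (w := (hj.trans_lt hlt).trans_eq hlen.symm)
    simp only [hj, List.getElem_map, List.getElem_range, decide_eq_true_eq] at h1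
    omega

lemma tailLength_spec (h : IsRowBounds D i₀ ℓ β) (hlast : D.lastRow = 1) {j : ℕ}
    (hj : D.tailLength = j + 1) :
    j ≤ ℓ ∧ (∀ t < j, β (ℓ - 1 - t) = β (ℓ - 1 - t + 1) + 1) ∧
      (j < ℓ → β (ℓ - 1 - j + 1) + 2 ≤ β (ℓ - 1 - j)) := by
  rw [Diagram.tailLength, if_pos hlast, h.rowSizes_eq, Nat.add_right_cancel_iff] at hj
  have hlen : ((List.range ℓ).map fun t => β t - β (t + 1)).reverse.length = ℓ := by simp
  have hle : j ≤ ℓ := by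
    rw [← hj]
    exact List.findIdx_le_length.trans_eq hlen
  refine ⟨hle, fun t ht => ?_, fun hlt => ?_⟩
  · have h1 := List.not_of_lt_findIdx (hj ▸ ht)
    have h2 := h.lt (ℓ - 1 - t) (by omega)
    simp at h1
    omega
  · have h1 := List.findIdx_getElem (w := (hj.trans_lt hlt).trans_eq hlen.symm)
    simp only [hj, List.getElem_reverse, List.getElem_map, List.getElem_range, List.length_map,
      List.length_range, decide_eq_true_eq] at h1
    omega

/-- The row bounds near the head. -/
lemma head_bounds (h : IsRowBounds D i₀ ℓ β) {j : ℕ} (hj : D.headLength = j + 1) (hlt : j < ℓ) :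
    (∀ t ≤ j, β t + t = β 0) ∧ ∀ t, j < t → t ≤ ℓ → β t + (j + 1) < β 0 := by
  obtain ⟨-, h1, h2⟩ := h.headLength_spec hj
  have h3 : ∀ t ≤ j, β t + t = β 0 := by
    intro t
    induction t with
    | zero => simp
    | succ t ih =>
      intro ht
      have := ih (by omega)
      have := h1 t (by omega)
      omega
  refine ⟨h3, fun t ht ht' => ?_⟩
  have := h.le_of_le (t := j + 1) (u := t) ht ht'
  have := h2 hlt
  have := h3 j le_rfl
  omega

/-- The row bounds near the tail. -/
lemma tail_bounds (h : IsRowBounds D i₀ ℓ β) (hlast : D.lastRow = 1) {j : ℕ}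
    (hj : D.tailLength = j + 1) (hlt : j < ℓ) :
    (∀ t ≤ j, β (ℓ - t) = β ℓ + t) ∧ ∀ t, t + j < ℓ → β ℓ + (j + 1) < β t := by
  obtain ⟨-, h1, h2⟩ := h.tailLength_spec hlast hj
  have h3 : ∀ t ≤ j, β (ℓ - t) = β ℓ + t := by
    intro t
    induction t with
    | zero => simp
    | succ t ih =>
      intro ht
      have := ih (by omega)
      have h4 := h1 t (by omega)
      have e : ℓ - 1 - t + 1 = ℓ - t := by omega
      have e' : ℓ - 1 - t = ℓ - (t + 1) := by omega
      rw [e, e'] at h4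
      omega
  refine ⟨h3, fun t ht => ?_⟩
  have := h.le_of_le (t := t) (u := ℓ - 1 - j) (by omega) (by omega)
  have h4 := h2 hlt
  have := h3 j le_rfl
  have e : ℓ - 1 - j + 1 = ℓ - j := by omega
  rw [e] at h4
  omega

/-- A ribbon all of whose rows are single boxes is a column. -/
lemma isBasicBlock_of_column (h : IsRowBounds D i₀ ℓ β) (h1 : ∀ t < ℓ, β t = β (t + 1) + 1) :
    D.IsBasicBlock := by
  have h2 : ∀ t ≤ ℓ, β t + t = β 0 := by
    intro t
    induction t with
    | zero => simp
    | succ t ih =>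
      intro ht
      have := ih (by omega)
      have := h1 t (by omega)
      omega
  refine ⟨ℓ, h.pos, _, Or.inr (Or.inl rfl), ((i₀ : ℤ), (i₀ : ℤ) + β 0 - 1), ?_⟩
  ext b
  simp only [h.mem, Diagram.transpose, Diagram.triangle, Finset.mem_image, mem_shiftedSkewDiagram]
  constructor
  · rintro ⟨t, ht, x, h3, h4, rfl⟩
    refine ⟨((t : ℤ), 0), ⟨(0, t), ⟨0, t, by simp, by simpa using ht, by simp⟩, rfl⟩, ?_⟩
    have := h1 t ht
    have := h2 t ht.le
    simp only [Prod.mk_add_mk, Prod.mk.injEq]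
    omega
  · rintro ⟨_, ⟨_, ⟨i, t, h3, h4, rfl⟩, rfl⟩, rfl⟩
    obtain rfl : i = 0 := by
      by_contra hi
      rw [List.getD_eq_default _ _ (by simp; omega)] at h4
      omega
    have h4 : t < ℓ := by simpa using h4
    refine ⟨t, h4, β (t + 1), le_rfl, h.lt t h4, ?_⟩
    have := h1 t h4
    have := h2 t h4.le
    simp only [Prod.mk_add_mk, Prod.mk.injEq]
    omega

end IsRowBounds

end Shape

theorem mainTheorem8 (lam mu : List ℕ)
    (hlam : IsStrictPartition lam) (hmu : IsStrictPartition mu) (hsub : PartitionLE mu lam)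
    (D : Diagram) (hD : D = shiftedSkewDiagram lam mu)
    (hconn : D.IsConnected) (hrib : D.IsRibbon) (hB : ¬ D.IsBasicBlock)
    (hodd : Odd D.card) (hfirst : D.firstRow = 1) (hlen : Odd D.length)
    (k m : ℕ) (hk : k = D.headLength) (hm : m = D.tailLength) :
    (1 < D.lastRow ∧ Even k → ¬ IsPPositive (skewSchurQ lam mu)) ∧
    (1 < D.lastRow ∧ Odd k ∧ Even m → ¬ IsPPositive (skewSchurQ lam mu)) ∧
    (D.lastRow = 1 ∧ k = m → ¬ IsPPositive (skewSchurQ lam mu)) := by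
  obtain ⟨i₀, ℓ, β, h⟩ : ∃ i₀ ℓ β, IsRowBounds D i₀ ℓ β := by
    subst hD
    exact exists_isRowBounds hmu hconn hrib
  rw [skewSchurQ, ← hD]
  rw [h.length_eq] at hlen
  rw [h.card_eq] at hodd
  rw [h.firstRow_eq] at hfirst
  have hℓ := h.pos
  obtain ⟨j, hj⟩ : ∃ j, D.headLength = j + 1 := ⟨_, rfl⟩
  have hjk : k = j + 1 := hk.trans hj
  have hspec := h.headLength_spec hj
  have hjℓ : j < ℓ := by
    by_contra hcon
    exact hB (h.isBasicBlock_of_column fun t ht => hspec.2.1 t (by omega))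
  obtain ⟨hhead, hhead'⟩ := h.head_bounds hj hjℓ
  have hj0 : 0 < j := by
    by_contra hcon
    have h1 := hspec.2.2 hjℓ
    obtain rfl : j = 0 := by omega
    rw [zero_add] at h1
    omega
  have hn := hhead' ℓ hjℓ le_rfl
  have htot := h.le_of_le (Nat.zero_le ℓ) le_rfl
  set s := IsRowBounds.stepIndicator ℓ β with hs
  have hs01 : ∀ p, s p = 0 ∨ s p = 1 := IsRowBounds.stepIndicator_cases ℓ β
  have hs1 : ∀ {t p}, 0 < t → t < ℓ → β t = β ℓ + p → s p = 1 :=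
    fun h0 h1 h2 => IsRowBounds.stepIndicator_eq_one h0 h1 h2
  have hs0 : ∀ {p}, (∀ t, 0 < t → t < ℓ → β t ≠ β ℓ + p) → s p = 0 :=
    fun h0 => IsRowBounds.stepIndicator_eq_zero h0
  obtain ⟨n, hβn⟩ := Nat.exists_eq_add_of_le (show β ℓ ≤ β 0 by omega)
  have hnodd : Odd n := by rwa [hβn, Nat.add_sub_cancel_left] at hodd
  have top : ∀ p q, 0 < p → p ≤ j → p + q = n → s q = 1 := by
    intro p q h1 h2 h3
    have := hhead p h2
    exact hs1 h1 (by omega) (by omega)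
  have top' : ∀ q, j + 1 + q = n → s q = 0 := by
    intro q h1
    refine hs0 fun t ht ht' => ?_
    rcases le_or_gt t j with h2 | h2
    · have := hhead t h2
      omega
    · have := hhead' t h2 ht'.le
      omega
  have main := fun (hpos : IsPPositive (tableauSeries D)) {a b c : ℕ} (habc : a + b + c = n)
    (ha : Odd a) (hb : Odd b) (hc : Odd c) =>
    h.nonneg_of_isPPositive hlen hpos (hβn.trans (congrArg (β ℓ + ·) habc.symm)) ha hb hc hs
  refine ⟨?_, ?_, ?_⟩
  · rintro ⟨hlast, hkeven⟩ hpos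
    rw [h.lastRow_eq] at hlast
    obtain ⟨c, hc⟩ := Nat.exists_eq_add_of_le (show 1 + j ≤ n by omega)
    have hjo : Odd j := by rw [hjk] at hkeven; grind
    have := main hpos hc.symm odd_one hjo (by grind)
    have e1 : s 1 = 0 := by
      refine hs0 fun t ht ht' => ?_
      have := h.le_of_le (t := t) (u := ℓ - 1) (by omega) (by omega)
      omega
    have e2 : s c = 0 := top' c (by omega)
    have e3 : s (j + c) = 1 := top 1 _ (by omega) (by omega) (by omega)
    have e4 : s (1 + c) = 1 := top j _ (by omega) (by omega) (by omega)
    rw [e1, e2, e3, e4] at this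
    rcases hs01 j with h1 | h1 <;> rcases hs01 (1 + j) with h2 | h2 <;> rw [h1, h2] at this <;>
      omega
  · rintro ⟨hlast, -, hmeven⟩ hpos
    have hm' : m = β (ℓ - 1) - β ℓ := by
      rw [hm, Diagram.tailLength, if_neg (by omega), h.lastRow_eq]
    have hℓ2 : 1 < ℓ := by omega
    rw [h.lastRow_eq, ← hm'] at hlast
    obtain ⟨b, rfl⟩ : ∃ b, m = 1 + b := ⟨m - 1, by omega⟩
    have hle := h.le_of_le (t := 1) (u := ℓ - 1) (by omega) (by omega)
    obtain ⟨c, hc⟩ := Nat.exists_eq_add_of_le (show 1 + b ≤ n by omega)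
    have := main hpos hc.symm odd_one (by grind) (by grind)
    have low : ∀ p, 0 < p → p < 1 + b → s p = 0 := by
      intro p hp hp'
      refine hs0 fun t ht ht' => ?_
      have := h.le_of_le (t := t) (u := ℓ - 1) (by omega) (by omega)
      omega
    have e1 : s 1 = 0 := low 1 (by omega) (by omega)
    have e2 : s b = 0 := low b (by omega) (by omega)
    have e3 : s (1 + b) = 1 := hs1 (t := ℓ - 1) (by omega) (by omega) (by omega)
    have e4 : s (b + c) = 1 := top 1 _ (by omega) (by omega) (by omega)
    rw [e1, e2, e3, e4] at this
    rcases hs01 c with h1 | h1 <;> rcases hs01 (1 + c) with h2 | h2 <;> rw [h1, h2] at this <;>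
      omega
  · rintro ⟨hlast, hkm⟩ hpos
    obtain ⟨htail, htail'⟩ := h.tail_bounds hlast (j := j) (by omega) hjℓ
    have bot : ∀ p, 0 < p → p ≤ j → s p = 1 := by
      intro p h1 h2
      exact hs1 (t := ℓ - p) (by omega) (by omega) (htail p h2)
    have bot' : s (j + 1) = 0 := by
      refine hs0 fun t ht ht' => ?_
      by_cases h2 : t + j < ℓ
      · have := htail' t h2
        omega
      · have := htail (ℓ - t) (by omega)
        rw [Nat.sub_sub_self ht'.le] at this
        omega
    rcases Nat.even_or_odd j with hje | hjo
    · obtain ⟨c, hc⟩ := Nat.exists_eq_add_of_le (show (j + 1) + 1 ≤ n by grind)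
      have := main hpos hc.symm (by grind) odd_one (by grind)
      have e1 : s 1 = 1 := bot 1 (by omega) (by omega)
      have e2 : s (1 + c) = 0 := top' _ (by omega)
      have e3 : s (j + 1 + c) = 1 := top 1 _ (by omega) (by omega) (by omega)
      rw [bot', e1, e2, e3] at this
      rcases hs01 c with h1 | h1 <;> rcases hs01 (j + 1 + 1) with h2 | h2 <;>
        rw [h1, h2] at this <;> omega
    · obtain ⟨c, hc⟩ := Nat.exists_eq_add_of_le (show 1 + j ≤ n by omega)
      have := main hpos hc.symm odd_one hjo (by grind)
      have e1 : s 1 = 1 := bot 1 (by omega) (by omega)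
      have e2 : s j = 1 := bot j (by omega) (by omega)
      have e3 : s (1 + j) = 0 := by rw [add_comm]; exact bot'
      have e4 : s c = 0 := top' _ (by omega)
      have e5 : s (1 + c) = 1 := top j _ (by omega) (by omega) (by omega)
      have e6 : s (j + c) = 1 := top 1 _ (by omega) (by omega) (by omega)
      rw [e1, e2, e3, e4, e5, e6] at this
      omega
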